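/- Let $n,n'\ge 1$, let $q\ge 3$ be a prime power, with $q$ odd if at least one of $n,n'$ is odd, and let $V$ be a vector space of dimension $n+n'$ over $\mathbb F_q$ with a quadratic form $Q$ whose polar form $\beta(u,v)=Q(u+v)-Q(u)-Q(v)$ is non-degenerate (throughout, "non-degenerate" means that the polar form has zero radical). The isometry type of a non-degenerate orthogonal space of dimension $d$ and Witt index $w$ (the maximal dimension of a totally singular subspace) is $+$ (hyperbolic) if $d=2w$, $\circ$ (parabolic) if $d=2w+1$, and $-$ (elliptic) if $d=2w+2$; let $\varepsilon$ be the isometry type of $V$. The subspace type $\sigma\in\{+,-\}$ of a non-degenerate subspace $U$ of $V$ is defined as follows: if $\dim U$ is even, $\sigma$ is the isometry type of $Q|_U$; if $\dim U$ is odd and $\dim U^\perp$ is even, $\sigma$ is the isometry type of $Q|_{U^\perp}$; if both are odd, $\sigma=+$ if a Gram matrix of the polar form of $Q|_U$ has square determinant, and $\sigma=-$ otherwise. For $\sigma,\sigma'\in\{+,-\}$ let $\mathcal U$ (respectively $\mathcal U'$) be the set of non-degenerate subspaces of $V$ of dimension $n$ and subspace type $\sigma$ (respectively dimension $n'$ and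 subspace type $\sigma'$), and fix $U\in\mathcal U$. Then $\mathcal U'$ is non-empty, and $$\varphi=\frac{|\{U'\in\mathcal U' : U\cap U'\ne 0\}|}{|\mathcal U'|}\le\frac{43}{16q},$$ except when $(n,n',q,\varepsilon)=(1,1,3,+)$ and $\sigma=\sigma'$, in which case $\varphi=1$. -/

import Mathlib

noncomputable section

namespace OrthSpace

open Module

/-- The isometry types of non-degenerate orthogonal spaces over a finite field. -/
inductive IsometryType where
  | hyperbolic
  | elliptic
  | parabolic

/-- The two possible values `+` and `-` of a subspace type. -/
inductive Sign where
  | plus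
  | minus

/-- `+` stands for hyperbolic and `-` for elliptic. -/
def Sign.toIsometryType : Sign → IsometryType
  | .plus => .hyperbolic
  | .minus => .elliptic

variable {F : Type*} [Field F] {V : Type*} [AddCommGroup V] [Module F V]

/-- The form `Q` is non-degenerate: the radical of its polar form
`β(u, v) = Q(u + v) - Q(u) - Q(v)` is zero. -/
def IsNondegenerate (Q : QuadraticForm F V) : Prop :=
  (QuadraticMap.polarBilin Q).Nondegenerate

/-- The Witt index: the maximal dimension of a totally singular subspace. -/
def wittIndex (Q : QuadraticForm F V) : ℕ :=
  sSup {k : ℕ | ∃ W : Submodule F V, (∀ w ∈ W, Q w = 0) ∧ finrank F W = k}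

/-- The isometry type of a (non-degenerate) orthogonal space over a finite field, in terms of its
dimension and its Witt index. -/
def HasIsometryType (Q : QuadraticForm F V) : IsometryType → Prop
  | .hyperbolic => finrank F V = 2 * wittIndex Q
  | .parabolic => finrank F V = 2 * wittIndex Q + 1
  | .elliptic => finrank F V = 2 * wittIndex Q + 2

/-- The orthogonal complement of `U` with respect to the polar form of `Q`. -/
def perp (Q : QuadraticForm F V) (U : Submodule F V) : Submodule F V :=
  U.orthogonalBilin (QuadraticMap.polarBilin Q)

variable [Module.Finite F V]

/-- The determinant of a Gram matrix of the polar form of `Q` (with respect to some basis);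
another basis changes it by a non-zero square factor. -/
def gramDet (Q : QuadraticForm F V) : F :=
  (Matrix.of fun i j =>
    QuadraticMap.polar Q (Module.finBasis F V i) (Module.finBasis F V j)).det

/-- `δ = +` if the discriminant is a square, and `δ = -` if it is a non-square. -/
def HasDelta (Q : QuadraticForm F V) : Sign → Prop
  | .plus => IsSquare (gramDet Q)
  | .minus => ¬ IsSquare (gramDet Q)

open Classical in
/-- `U` has subspace type `σ` in `V`. -/
def HasSubspaceType (Q : QuadraticForm F V) (U : Submodule F V) (σ : Sign) : Prop :=
  if Even (finrank F U) then HasIsometryType (Q.restrict U) σ.toIsometryType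
  else if Even (finrank F (perp Q U)) then
    HasIsometryType (Q.restrict (perp Q U)) σ.toIsometryType
  else HasDelta (Q.restrict U) σ

/-- The set of non-degenerate `n`-dimensional subspaces of `V` of subspace type `σ`. -/
def nondegSubspaces (Q : QuadraticForm F V) (n : ℕ) (σ : Sign) : Set (Submodule F V) :=
  {U | finrank F U = n ∧ IsNondegenerate (Q.restrict U) ∧ HasSubspaceType Q U σ}

/-- The proportion of members of a (finite) set `S` of subspaces that meet `U` non-trivially. -/
def meetProportion (U : Submodule F V) (S : Set (Submodule F V)) : ℚ :=
  (({U' ∈ S | U ⊓ U' ≠ ⊥}.ncard : ℕ) : ℚ) / ((S.ncard : ℕ) : ℚ)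

end OrthSpace

end

/-! The bound is a union bound over the points of $U$. If $U\cap U'\ne 0$, then $U\cap U'$ contains
at least $q-1$ non-zero vectors. Isometries are transitive on the non-zero vectors of a given value
of $Q$ (`exists_isometry_map_eq`) and preserve $\mathcal U'$ (`map_mem_nondegSubspaces`). Writing
$N_W(t)$ for `nonzeroCount Q W t`, a double count shows that $(q-1)\varphi$ is at most the average
over $U'$ of $\sum_t N_U(t)N_{U'}(t)/N_V(t)$, which is `pairSum` (`mul_card_filter_inf_ne_bot_le`).

The counts come from splitting off hyperbolic planes until the rest is anisotropic, hence of
dimension at most 2. In even dimension a sign governs them (`exists_hasSignedCounts`); in odd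
dimension `valueCount_odd` leaves two options for each non-zero value. No division by 2 occurs here,
so even $q$ needs no separate treatment. The estimate `pairSum_le_bound` is then uniform once some
dimension is at least 3, and the pairs (1,1), (1,2), (2,2) are done by hand.

It fails only for two lines in a hyperbolic plane over $\mathbb F_3$. There, distinct types give
$\varphi=0$, since lines that meet coincide, and equal types give $\varphi=1$, since the square
class determines the value of $Q$ and only $\pm u$ take the value $Q(u)$.

Non-emptiness is a construction: hyperbolic planes, plus one anisotropic plane for the type $-$,
give the even dimensions. Odd dimensions follow by taking complements, or by adjoining an orthogonal
vector of prescribed value. -/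

noncomputable section

namespace OrthSpace

open Module QuadraticMap

/-! ### Hyperbolic pairs and splitting off a hyperbolic plane. -/

section Subspaces

variable {F : Type*} [Field F] {V : Type*} [AddCommGroup V] [Module F V]

theorem map_add_eq (Q : QuadraticForm F V) (x y : V) : Q (x + y) = Q x + Q y + polar Q x y :=
  QuadraticMap.map_add Q x y

theorem map_smul_eq (Q : QuadraticForm F V) (a : F) (x : V) : Q (a • x) = a * a * Q x :=
  QuadraticMap.map_smul Q a x

theorem map_sub_eq (Q : QuadraticForm F V) (x y : V) : Q (x - y) = Q x + Q y - polar Q x y := by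
  rw [sub_eq_add_neg, map_add_eq, QuadraticMap.map_neg, polar_neg_right]
  ring

theorem polar_self_eq (Q : QuadraticForm F V) (x : V) : polar Q x x = 2 * Q x := by
  rw [polar_self, nsmul_eq_mul]
  norm_num

/-- The polar form of `Q` has zero radical on the subspace `U`. -/
def IsNondegenerateOn (Q : QuadraticForm F V) (U : Submodule F V) : Prop :=
  ∀ v ∈ U, (∀ u ∈ U, polar Q v u = 0) → v = 0

theorem nondegenerate_polarBilin_iff (Q : QuadraticForm F V) :
    IsNondegenerate Q ↔ ∀ v, (∀ u, polar Q v u = 0) → v = 0 := by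
  constructor
  · intro h v hv
    exact h.1 v hv
  · intro h
    refine ⟨fun v hv => h v hv, fun v hv => h v fun u => ?_⟩
    rw [polar_comm]
    exact hv u

theorem isNondegenerate_iff (Q : QuadraticForm F V) :
    IsNondegenerate Q ↔ IsNondegenerateOn Q ⊤ := by
  simp [nondegenerate_polarBilin_iff, IsNondegenerateOn]

theorem isNondegenerate_restrict_iff (Q : QuadraticForm F V) (U : Submodule F V) :
    IsNondegenerate (Q.restrict U) ↔ IsNondegenerateOn Q U := by
  have hp : ∀ v u : U, polar (Q.restrict U) v u = polar Q v u := fun v u => by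
    simp [polar, restrict_apply]
  rw [nondegenerate_polarBilin_iff]
  constructor
  · intro h v hv hvu
    have := h ⟨v, hv⟩ fun u => by rw [hp]; exact hvu u u.2
    simpa using this
  · intro h v hv
    have := h v v.2 fun u hu => by rw [← hp v ⟨u, hu⟩]; exact hv ⟨u, hu⟩
    simpa using this

theorem mem_perp {Q : QuadraticForm F V} {U : Submodule F V} {v : V} :
    v ∈ perp Q U ↔ ∀ u ∈ U, polar Q u v = 0 := by
  simp [perp, Submodule.mem_orthogonalBilin_iff]

theorem IsNondegenerateOn.exists_polar_ne_zero {Q : QuadraticForm F V} {U : Submodule F V}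
    (hU : IsNondegenerateOn Q U) {v : V} (hv : v ∈ U) (hv0 : v ≠ 0) :
    ∃ u ∈ U, polar Q v u ≠ 0 := by
  by_contra! h
  exact hv0 (hU v hv h)

/-- `e`, `f` span a hyperbolic plane and are singular. -/
structure IsHyperbolicPair (Q : QuadraticForm F V) (e f : V) : Prop where
  left : Q e = 0
  right : Q f = 0
  polar_eq_one : polar Q e f = 1

/-- The map `(a, b, u) ↦ a e + b f + u`. -/
def hyperbolicMap (e f : V) (W : Submodule F V) : (F × F × W) →ₗ[F] V :=
  (LinearMap.toSpanSingleton F V e).coprod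
    ((LinearMap.toSpanSingleton F V f).coprod W.subtype)

@[simp]
theorem hyperbolicMap_apply (e f : V) (W : Submodule F V) (p : F × F × W) :
    hyperbolicMap e f W p = p.1 • e + (p.2.1 • f + p.2.2) := rfl

/-- The subspace spanned by `e`, `f` and `W`. -/
def hyperbolicSum (e f : V) (W : Submodule F V) : Submodule F V :=
  LinearMap.range (hyperbolicMap e f W)

theorem mem_hyperbolicSum {e f : V} {W : Submodule F V} {v : V} :
    v ∈ hyperbolicSum e f W ↔ ∃ a b : F, ∃ w ∈ W, v = a • e + (b • f + w) := by
  constructor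
  · rintro ⟨⟨a, b, w⟩, rfl⟩
    exact ⟨a, b, w, w.2, rfl⟩
  · rintro ⟨a, b, w, hw, rfl⟩
    exact ⟨⟨a, b, w, hw⟩, rfl⟩

variable {Q : QuadraticForm F V} {e f : V} {W : Submodule F V}

theorem IsHyperbolicPair.polar_eq_one' (h : IsHyperbolicPair Q e f) : polar Q f e = 1 := by
  rw [polar_comm, h.polar_eq_one]

theorem IsHyperbolicPair.polar_left_self (h : IsHyperbolicPair Q e f) : polar Q e e = 0 := by
  rw [polar_self, h.left, smul_zero]

theorem IsHyperbolicPair.polar_right_self (h : IsHyperbolicPair Q e f) : polar Q f f = 0 := by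
  rw [polar_self, h.right, smul_zero]

theorem IsHyperbolicPair.map_combination (h : IsHyperbolicPair Q e f) (a b : F) {w : V}
    (hew : polar Q e w = 0) (hfw : polar Q f w = 0) :
    Q (a • e + (b • f + w)) = a * b + Q w := by
  rw [map_add_eq, map_add_eq Q (b • f), map_smul_eq, map_smul_eq, h.left, h.right]
  simp only [polar_add_right, polar_smul_left, polar_smul_right, h.polar_eq_one, hew, hfw,
    smul_eq_mul]
  ring

theorem IsHyperbolicPair.polar_left (h : IsHyperbolicPair Q e f) (a b : F) {w : V}
    (hew : polar Q e w = 0) : polar Q e (a • e + (b • f + w)) = b := by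
  simp [polar_add_right, polar_smul_right, h.polar_eq_one, hew, h.polar_left_self]

theorem IsHyperbolicPair.polar_right (h : IsHyperbolicPair Q e f) (a b : F) {w : V}
    (hfw : polar Q f w = 0) : polar Q f (a • e + (b • f + w)) = a := by
  simp [polar_add_right, polar_smul_right, h.polar_eq_one', hfw, h.polar_right_self]

theorem IsHyperbolicPair.hyperbolicMap_injective (h : IsHyperbolicPair Q e f)
    (he : ∀ w ∈ W, polar Q e w = 0) (hf : ∀ w ∈ W, polar Q f w = 0) :
    Function.Injective (hyperbolicMap e f W) := by
  rw [injective_iff_map_eq_zero]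
  rintro ⟨a, b, w⟩ hp
  rw [hyperbolicMap_apply] at hp
  have hb := h.polar_left a b (he w w.2)
  have ha := h.polar_right a b (hf w w.2)
  simp only at hp
  rw [hp, polar_zero_right] at ha hb
  subst ha hb
  simp at hp
  simp [hp]

theorem IsHyperbolicPair.finrank_hyperbolicSum [Module.Finite F V] (h : IsHyperbolicPair Q e f)
    (he : ∀ w ∈ W, polar Q e w = 0) (hf : ∀ w ∈ W, polar Q f w = 0) :
    finrank F (hyperbolicSum e f W) = finrank F W + 2 := by
  rw [hyperbolicSum, LinearMap.finrank_range_of_inj (h.hyperbolicMap_injective he hf)]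
  simp only [finrank_prod, finrank_self]
  ring

theorem IsHyperbolicPair.isNondegenerateOn_hyperbolicSum (h : IsHyperbolicPair Q e f)
    (he : ∀ w ∈ W, polar Q e w = 0) (hf : ∀ w ∈ W, polar Q f w = 0)
    (hW : IsNondegenerateOn Q W) : IsNondegenerateOn Q (hyperbolicSum e f W) := by
  intro v hv hvu
  obtain ⟨a, b, w, hw, rfl⟩ := mem_hyperbolicSum.1 hv
  have hE := hvu e (mem_hyperbolicSum.2 ⟨1, 0, 0, W.zero_mem, by simp⟩)
  have hF := hvu f (mem_hyperbolicSum.2 ⟨0, 1, 0, W.zero_mem, by simp⟩)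
  rw [polar_comm, h.polar_left a b (he w hw)] at hE
  rw [polar_comm, h.polar_right a b (hf w hw)] at hF
  subst hE hF
  have : w = 0 := hW w hw fun u hu => by
    have := hvu u (mem_hyperbolicSum.2 ⟨0, 0, u, hu, by simp⟩)
    simpa using this
  simp [this]

/-- A singular vector of a non-degenerate subspace splits off a hyperbolic plane. -/
theorem IsNondegenerateOn.exists_hyperbolicSum {U : Submodule F V} (hU : IsNondegenerateOn Q U)
    (heU : e ∈ U) (he0 : e ≠ 0) (he : Q e = 0) :
    ∃ f ∈ U, ∃ W ≤ U, IsHyperbolicPair Q e f ∧ (∀ w ∈ W, polar Q e w = 0) ∧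
      (∀ w ∈ W, polar Q f w = 0) ∧ IsNondegenerateOn Q W ∧ U = hyperbolicSum e f W := by
  obtain ⟨g, hg, hgne⟩ := hU.exists_polar_ne_zero heU he0
  obtain ⟨g', hg'U, h1⟩ : ∃ g' ∈ U, polar Q e g' = 1 :=
    ⟨(polar Q e g)⁻¹ • g, U.smul_mem _ hg, by simp [polar_smul_right, hgne]⟩
  -- Subtracting `Q g' • e` makes `g'` singular and keeps its pairing with `e`, because `e` is
  -- singular.
  have hpair : IsHyperbolicPair Q e (g' - Q g' • e) := by
    refine ⟨he, ?_, ?_⟩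
    · rw [sub_eq_add_neg, ← neg_smul, map_add_eq, map_smul_eq, he,
        polar_smul_right, polar_comm, h1]
      simp
    · rw [sub_eq_add_neg, ← neg_smul, polar_add_right, polar_smul_right _ _ e, polar_self, he, h1]
      simp
  set f := g' - Q g' • e with hf
  have hfU : f ∈ U := U.sub_mem hg'U (U.smul_mem _ heU)
  let W : Submodule F V := U ⊓ (LinearMap.ker (polarBilin Q e) ⊓ LinearMap.ker (polarBilin Q f))
  have hWe : ∀ w ∈ W, polar Q e w = 0 := fun w hw => hw.2.1
  have hWf : ∀ w ∈ W, polar Q f w = 0 := fun w hw => hw.2.2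
  have hUW : U = hyperbolicSum e f W := by
    apply le_antisymm
    · intro u hu
      rw [mem_hyperbolicSum]
      refine ⟨polar Q f u, polar Q e u, u - polar Q f u • e - polar Q e u • f, ⟨?_, ?_, ?_⟩, by abel⟩
      · exact U.sub_mem (U.sub_mem hu (U.smul_mem _ heU)) (U.smul_mem _ hfU)
      · simp [polar_sub_right, polar_smul_right, hpair.polar_left_self, hpair.polar_eq_one]
      · simp [polar_sub_right, polar_smul_right, hpair.polar_right_self, hpair.polar_eq_one']
    · intro u hu
      obtain ⟨a, b, w, hw, rfl⟩ := mem_hyperbolicSum.1 hu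
      exact U.add_mem (U.smul_mem _ heU) (U.add_mem (U.smul_mem _ hfU) hw.1)
  refine ⟨f, hfU, W, inf_le_left, hpair, hWe, hWf, ?_, hUW⟩
  intro w hw hwu
  refine hU w hw.1 fun u hu => ?_
  rw [hUW] at hu
  obtain ⟨a, b, w', hw', rfl⟩ := mem_hyperbolicSum.1 hu
  rw [polar_add_right, polar_add_right, polar_smul_right, polar_smul_right, polar_comm (⇑Q) w e,
    polar_comm (⇑Q) w f, hWe w hw, hWf w hw, hwu w' hw']
  simp

end Subspaces

/-! ### Value counts: one hyperbolic step, and anisotropic spaces. -/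

section Counting

variable {F : Type*} [Field F] {V : Type*} [AddCommGroup V] [Module F V]

/-- The number of vectors of `U` on which `Q` takes the value `t`. -/
def valueCount (Q : QuadraticForm F V) (U : Submodule F V) (t : F) : ℕ :=
  Nat.card {v : V // v ∈ U ∧ Q v = t}

variable [Finite F] [Module.Finite F V] {Q : QuadraticForm F V} {e f : V} {W : Submodule F V}

theorem natCard_ne_zero_add_one : Nat.card {a : F // a ≠ 0} + 1 = Nat.card F := by
  classical
  have : Fintype F := Fintype.ofFinite F
  rw [Nat.card_eq_fintype_card, Nat.card_eq_fintype_card, Fintype.card_subtype_compl,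
    Fintype.card_subtype_eq]
  have := Fintype.card_pos (α := F)
  omega

/-- The equation is $ab+Q(w)=t$. If $a\ne0$, then $w$ is free and determines $b$; if $a=0$, then $b$
is free and $Q(w)=t$. These are the two summands. -/
theorem IsHyperbolicPair.valueCount_hyperbolicSum (h : IsHyperbolicPair Q e f)
    (he : ∀ w ∈ W, polar Q e w = 0) (hf : ∀ w ∈ W, polar Q f w = 0) (t : F) :
    valueCount Q (hyperbolicSum e f W) t =
      (Nat.card F - 1) * Nat.card F ^ finrank F W + Nat.card F * valueCount Q W t := by
  classical
  have : Finite V := Module.finite_of_finite F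
  let g : ({a : F // a ≠ 0} × W) ⊕ (F × {v : V // v ∈ W ∧ Q v = t}) →
      {v : V // v ∈ hyperbolicSum e f W ∧ Q v = t} :=
    Sum.elim
      (fun p => ⟨p.1.1 • e + ((p.1.1⁻¹ * (t - Q p.2)) • f + p.2),
        mem_hyperbolicSum.2 ⟨_, _, _, p.2.2, rfl⟩, by
          rw [h.map_combination _ _ (he _ p.2.2) (hf _ p.2.2), mul_inv_cancel_left₀ p.1.2]
          ring⟩)
      (fun p => ⟨(0 : F) • e + (p.1 • f + p.2.1),
        mem_hyperbolicSum.2 ⟨_, _, _, p.2.2.1, rfl⟩, by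
          rw [h.map_combination _ _ (he _ p.2.2.1) (hf _ p.2.2.1), p.2.2.2]
          ring⟩)
  have hinj := h.hyperbolicMap_injective he hf
  have key : ∀ {a b a' b' : F} {w w' : V} (hw : w ∈ W) (hw' : w' ∈ W),
      a • e + (b • f + w) = a' • e + (b' • f + w') → a = a' ∧ b = b' ∧ w = w' := by
    intro a b a' b' w w' hw hw' heq
    have := @hinj ⟨a, b, w, hw⟩ ⟨a', b', w', hw'⟩ heq
    simpa using this
  have hg : Function.Bijective g := by
    constructor
    · rintro (⟨⟨a, ha⟩, w⟩ | ⟨b, w, hw⟩) (⟨⟨a', ha'⟩, w'⟩ | ⟨b', w', hw'⟩) heq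
      · obtain ⟨h1, -, h3⟩ := key w.2 w'.2 (congrArg Subtype.val heq)
        simp only at h1
        simp [h1, Subtype.ext h3]
      · obtain ⟨h1, -, h3⟩ := key w.2 hw'.1 (congrArg Subtype.val heq)
        exact absurd h1 ha
      · obtain ⟨h1, -, h3⟩ := key hw.1 w'.2 (congrArg Subtype.val heq)
        exact absurd h1.symm ha'
      · obtain ⟨h1, h2, h3⟩ := key hw.1 hw'.1 (congrArg Subtype.val heq)
        simp only at h2 h3
        simp [h2, h3]
    · rintro ⟨v, hv, hvt⟩
      obtain ⟨a, b, w, hw, rfl⟩ := mem_hyperbolicSum.1 hv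
      rw [h.map_combination a b (he w hw) (hf w hw)] at hvt
      by_cases ha : a = 0
      · subst ha
        exact ⟨Sum.inr ⟨b, w, hw, by simpa using hvt⟩, rfl⟩
      · refine ⟨Sum.inl ⟨⟨a, ha⟩, w, hw⟩, Subtype.ext ?_⟩
        have hb : a⁻¹ * (t - Q w) = b := by
          rw [← hvt]
          field_simp
          ring
        simp [g, hb]
  rw [valueCount, ← Nat.card_eq_of_bijective g hg, Nat.card_sum, Nat.card_prod, Nat.card_prod,
    Module.natCard_eq_pow_finrank (K := F) (V := W), valueCount]
  congr 2
  have := natCard_ne_zero_add_one (F := F)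
  omega

omit [Finite F] in
theorem natCard_polar_eq_zero {U : Submodule F V} (hU : IsNondegenerateOn Q U) {v : V}
    (hv : v ∈ U) (hv0 : v ≠ 0) :
    Nat.card {w : V // w ∈ U ∧ polar Q v w = 0} = Nat.card F ^ (finrank F U - 1) := by
  let φ : Module.Dual F U := (polarBilin Q v).comp U.subtype
  have hφ : φ ≠ 0 := by
    obtain ⟨u, hu, hne⟩ := hU.exists_polar_ne_zero hv hv0
    exact fun h => hne (LinearMap.congr_fun h ⟨u, hu⟩)
  have h1 := Module.Dual.finrank_ker_add_one_of_ne_zero hφ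
  have h2 : Nat.card {w : V // w ∈ U ∧ polar Q v w = 0} = Nat.card (LinearMap.ker φ) := by
    refine Nat.card_congr ⟨fun w => ⟨⟨w, w.2.1⟩, w.2.2⟩, fun w => ⟨w.1, w.1.2, w.2⟩, ?_, ?_⟩
    · intro w; rfl
    · intro w; rfl
  rw [h2, Module.natCard_eq_pow_finrank (K := F), ← h1, Nat.add_sub_cancel]

theorem natCard_polar_ne_zero {U : Submodule F V} (hU : IsNondegenerateOn Q U) {v : V}
    (hv : v ∈ U) (hv0 : v ≠ 0) :
    Nat.card F ^ (finrank F U - 1) + Nat.card {w : V // w ∈ U ∧ polar Q v w ≠ 0} =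
      Nat.card F ^ finrank F U := by
  classical
  have : Finite V := Module.finite_of_finite F
  rw [← natCard_polar_eq_zero hU hv hv0, ← Module.natCard_eq_pow_finrank (K := F) (V := U),
    ← Nat.card_sum]
  refine Nat.card_congr ⟨Sum.elim (fun w => ⟨w, w.2.1⟩) (fun w => ⟨w, w.2.1⟩),
    fun w => if h : polar Q v w = 0 then Sum.inl ⟨w, w.2, h⟩ else Sum.inr ⟨w, w.2, h⟩, ?_, ?_⟩
  · rintro (⟨w, hw⟩ | ⟨w, hw⟩)
    · simp [hw.2]
    · simp [hw.2]
  · intro w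
    by_cases h : polar Q v w = 0 <;> simp [h]

/-- In an anisotropic space every represented value is taken equally often. -/
theorem valueCount_of_anisotropic {U : Submodule F V} (hU : IsNondegenerateOn Q U)
    (han : ∀ x ∈ U, Q x = 0 → x = 0) {v : V} (hv : v ∈ U) (hv0 : v ≠ 0) :
    valueCount Q U (Q v) = Nat.card F ^ (finrank F U - 1) + 1 := by
  classical
  have : Finite V := Module.finite_of_finite F
  have hQs : ∀ x : V, Q x = Q v → polar Q v (x - v) = - Q (x - v) := by
    intro x hx
    rw [map_sub_eq, polar_sub_right, polar_self_eq, hx, polar_comm (⇑Q) x]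
    ring
  have hQne : ∀ x ∈ U, x ≠ v → Q (x - v) ≠ 0 := fun x hx hxv h =>
    hxv (sub_eq_zero.1 (han _ (U.sub_mem hx hv) h))
  -- Project the quadric $Q=Q(v)$ from its point $v$: a direction $w$ with $\beta(v,w)\ne0$ gives
  -- exactly one further point, $v-(\beta(v,w)/Q(w))w$, and by `hQs` every further point arises so.
  -- The scalar runs through the multiples of a direction.
  let g : {a : F // a ≠ 0} × {x : V // (x ∈ U ∧ Q x = Q v) ∧ x ≠ v} →
      {w : V // w ∈ U ∧ polar Q v w ≠ 0} := fun p =>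
    ⟨p.1.1 • (p.2.1 - v), U.smul_mem _ (U.sub_mem p.2.2.1.1 hv), by
      rw [polar_smul_right, hQs _ p.2.2.1.2, smul_eq_mul]
      exact mul_ne_zero p.1.2 (neg_ne_zero.2 (hQne _ p.2.2.1.1 p.2.2.2))⟩
  have hg : Function.Bijective g := by
    constructor
    · rintro ⟨⟨c, hc⟩, ⟨x, ⟨hxU, hxQ⟩, hxv⟩⟩ ⟨⟨c', hc'⟩, ⟨x', ⟨hxU', hxQ'⟩, hxv'⟩⟩ heq
      have h0 : c • (x - v) = c' • (x' - v) := congrArg Subtype.val heq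
      have h1 := congrArg (fun w => polar Q v w) h0
      have h2 := congrArg Q h0
      simp only [polar_smul_right, map_smul_eq, hQs x hxQ, hQs x' hxQ', smul_eq_mul] at h1 h2
      have hne := hQne x' hxU' hxv'
      have hcc : c = c' := by
        have h3 : c * (c' * Q (x' - v)) = c' * (c' * Q (x' - v)) := by
          linear_combination h2 + c * h1
        exact mul_right_cancel₀ (mul_ne_zero hc' hne) h3
      subst hcc
      have := smul_right_injective V hc h0
      simp only [sub_left_inj] at this
      simp [this]
    · rintro ⟨w, hwU, hw⟩
      have hw0 : w ≠ 0 := by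
        rintro rfl
        simp at hw
      have hQw : Q w ≠ 0 := fun h => hw0 (han w hwU h)
      refine ⟨⟨⟨-(Q w / polar Q v w), neg_ne_zero.2 (div_ne_zero hQw hw)⟩,
        ⟨v - (polar Q v w / Q w) • w, ⟨U.sub_mem hv (U.smul_mem _ hwU), ?_⟩, ?_⟩⟩, ?_⟩
      · rw [map_sub_eq, map_smul_eq, polar_smul_right]
        simp only [smul_eq_mul]
        field_simp
        ring
      · intro h
        rw [sub_eq_self, smul_eq_zero] at h
        exact h.elim (div_ne_zero hw hQw) hw0
      · apply Subtype.ext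
        simp only [g, sub_sub_cancel_left, smul_neg, smul_smul]
        rw [← neg_smul, neg_mul, neg_neg, div_mul_div_cancel₀ hw, div_self hQw, one_smul]
  have hc := Nat.card_eq_of_bijective g hg
  rw [Nat.card_prod] at hc
  have h1 := natCard_polar_ne_zero hU hv hv0
  have h2 := natCard_ne_zero_add_one (F := F)
  have h3 : valueCount Q U (Q v) = Nat.card {x : V // (x ∈ U ∧ Q x = Q v) ∧ x ≠ v} + 1 := by
    let _ : Unique {x : V // (x ∈ U ∧ Q x = Q v) ∧ x = v} :=
      ⟨⟨⟨v, ⟨hv, rfl⟩, rfl⟩⟩, fun x => Subtype.ext x.2.2⟩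
    rw [valueCount, ← Nat.card_unique (α := {x : V // (x ∈ U ∧ Q x = Q v) ∧ x = v}), add_comm,
      ← Nat.card_sum]
    refine Nat.card_congr ⟨fun w => if h : w.1 = v then Sum.inl ⟨w, w.2, h⟩ else Sum.inr ⟨w, w.2, h⟩,
      Sum.elim (fun w => ⟨w, w.2.1⟩) (fun w => ⟨w, w.2.1⟩), ?_, ?_⟩
    · intro w
      by_cases h : w.1 = v
      · simpa [h] using Subtype.ext h.symm
      · simp [h]
    · rintro (⟨w, hw⟩ | ⟨w, hw⟩)
      · simp [hw.2]
      · simp [hw.2]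
  rw [h3]
  congr 1
  have hd : 1 ≤ finrank F U := by
    rw [Nat.one_le_iff_ne_zero, ne_eq, Submodule.finrank_eq_zero]
    rintro rfl
    exact hv0 ((Submodule.mem_bot F).1 hv)
  obtain ⟨k, hk⟩ := Nat.exists_eq_add_of_le' hd
  rw [hk, Nat.add_sub_cancel, ← hc, ← h2, pow_succ] at h1
  have hpos : 0 < Nat.card {a : F // a ≠ 0} := by
    have : Nonempty {a : F // a ≠ 0} := ⟨⟨1, one_ne_zero⟩⟩
    exact Nat.card_pos
  rw [hk, Nat.add_sub_cancel, ← h2]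
  apply Nat.eq_of_mul_eq_mul_left hpos
  linarith

end Counting

/-! ### Value counts of all non-degenerate subspaces. -/

section Values

variable {F : Type*} [Field F] [Finite F] {V : Type*} [AddCommGroup V] [Module F V]
  [Module.Finite F V] {Q : QuadraticForm F V} {U : Submodule F V}

theorem sum_valueCount [Fintype F] (Q : QuadraticForm F V) (U : Submodule F V) :
    ∑ t, valueCount Q U t = Nat.card F ^ finrank F U := by
  have : Finite V := Module.finite_of_finite F
  rw [← Module.natCard_eq_pow_finrank (K := F) (V := U)]
  simp only [valueCount]
  rw [← Nat.card_sigma]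
  refine Nat.card_congr ⟨fun p => ⟨p.2.1, p.2.2.1⟩, fun u => ⟨Q u, u, u.2, rfl⟩, ?_, ?_⟩
  · rintro ⟨t, v, hv, rfl⟩
    rfl
  · intro u
    rfl

theorem valueCount_pos_iff {t : F} : 0 < valueCount Q U t ↔ ∃ v ∈ U, Q v = t := by
  have : Finite V := Module.finite_of_finite F
  rw [valueCount, Nat.card_pos_iff]
  constructor
  · rintro ⟨⟨v, hv, hvt⟩, -⟩
    exact ⟨v, hv, hvt⟩
  · rintro ⟨v, hv, hvt⟩
    exact ⟨⟨v, hv, hvt⟩, inferInstance⟩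

omit [Finite F] [Module.Finite F V] in
theorem valueCount_zero_of_anisotropic (han : ∀ x ∈ U, Q x = 0 → x = 0) :
    valueCount Q U 0 = 1 := by
  rw [valueCount, Nat.card_eq_one_iff_unique]
  refine ⟨⟨fun x y => Subtype.ext ?_⟩, ⟨⟨0, U.zero_mem, QuadraticMap.map_zero Q⟩⟩⟩
  rw [han x x.2.1 x.2.2, han y y.2.1 y.2.2]

theorem valueCount_ne_zero_of_anisotropic (hU : IsNondegenerateOn Q U)
    (han : ∀ x ∈ U, Q x = 0 → x = 0) {t : F} (ht : t ≠ 0) :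
    valueCount Q U t = 0 ∨ valueCount Q U t = Nat.card F ^ (finrank F U - 1) + 1 := by
  rcases Nat.eq_zero_or_pos (valueCount Q U t) with h | h
  · exact Or.inl h
  · obtain ⟨v, hv, rfl⟩ := valueCount_pos_iff.1 h
    refine Or.inr (valueCount_of_anisotropic hU han hv ?_)
    rintro rfl
    simp at ht

/-- `K` is the number of non-zero values represented on `U`. All are taken equally often, and the
zero vector accounts for the `+ 1`. -/
theorem exists_mul_add_one_of_anisotropic (hU : IsNondegenerateOn Q U)
    (han : ∀ x ∈ U, Q x = 0 → x = 0) :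
    ∃ K, K * (Nat.card F ^ (finrank F U - 1) + 1) + 1 = Nat.card F ^ finrank F U ∧
      (K + 1 = Nat.card F → ∀ t ≠ 0, valueCount Q U t = Nat.card F ^ (finrank F U - 1) + 1) := by
  classical
  have : Fintype F := Fintype.ofFinite F
  refine ⟨((Finset.univ.erase (0 : F)).filter fun t => valueCount Q U t ≠ 0).card, ?_, ?_⟩
  · rw [← sum_valueCount Q U, ← Finset.sum_erase_add _ _ (Finset.mem_univ (0 : F)),
      valueCount_zero_of_anisotropic han, ← Finset.sum_filter_ne_zero,
      Finset.sum_const_nat fun t ht => ?_]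
    rw [Finset.mem_filter, Finset.mem_erase] at ht
    exact (valueCount_ne_zero_of_anisotropic hU han ht.1.1).resolve_left ht.2
  · intro hK t ht
    have hcard : (Finset.univ.erase (0 : F)).card + 1 = Nat.card F := by
      rw [Finset.card_erase_add_one (Finset.mem_univ _), Finset.card_univ,
        Nat.card_eq_fintype_card]
    have heq := Finset.filter_card_eq (by omega :
      ((Finset.univ.erase (0 : F)).filter fun t => valueCount Q U t ≠ 0).card =
        (Finset.univ.erase (0 : F)).card)
    exact (valueCount_ne_zero_of_anisotropic hU han ht).resolve_left
      (heq t (Finset.mem_erase.2 ⟨ht, Finset.mem_univ _⟩))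

theorem one_lt_natCard : 1 < Nat.card F := Finite.one_lt_card

/-- With $d=\dim U$, $q^{d-1}+1$ divides $q^d-1$, hence also $q(q^{d-1}+1)-(q^d-1)=q+1$, which is
too small if $d\ge3$. -/
theorem finrank_le_two_of_anisotropic (hU : IsNondegenerateOn Q U)
    (han : ∀ x ∈ U, Q x = 0 → x = 0) : finrank F U ≤ 2 := by
  by_contra! hd
  obtain ⟨K, hK, -⟩ := exists_mul_add_one_of_anisotropic hU han
  obtain ⟨k, hk⟩ := Nat.exists_eq_add_of_lt hd
  have hq := one_lt_natCard (F := F)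
  set q := Nat.card F
  have hd1 : finrank F U - 1 = k + 2 := by omega
  have hd2 : finrank F U = k + 3 := by omega
  rw [hd1, hd2] at hK
  have hdvd : q ^ (k + 2) + 1 ∣ q + 1 := by
    have h1 : q ^ (k + 2) + 1 ∣ q * (q ^ (k + 2) + 1) := Dvd.intro_left _ rfl
    have h2 : q * (q ^ (k + 2) + 1) = K * (q ^ (k + 2) + 1) + (q + 1) := by
      have : q ^ (k + 3) = q * q ^ (k + 2) := by ring
      rw [this] at hK
      linarith
    rw [h2] at h1
    exact (Nat.dvd_add_right (Dvd.intro_left _ rfl)).1 h1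
  have hle := Nat.le_of_dvd (by omega) hdvd
  have : q ^ 1 < q ^ (k + 2) := Nat.pow_lt_pow_right hq (by omega)
  rw [pow_one] at this
  exact absurd hle (by linarith)

theorem valueCount_of_anisotropic_plane (hU : IsNondegenerateOn Q U)
    (han : ∀ x ∈ U, Q x = 0 → x = 0) (hd : finrank F U = 2) {t : F} (ht : t ≠ 0) :
    valueCount Q U t = Nat.card F + 1 := by
  obtain ⟨K, hK, h⟩ := exists_mul_add_one_of_anisotropic hU han
  have hq := one_lt_natCard (F := F)
  rw [hd] at hK h
  set q := Nat.card F
  simp only [Nat.add_one_sub_one, pow_one] at hK h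
  refine h ?_ t ht
  have : (K + 1) * (q + 1) = q * (q + 1) := by nlinarith
  exact Nat.eq_of_mul_eq_mul_right (by omega) this

open scoped Classical in
theorem valueCount_bot (Q : QuadraticForm F V) (t : F) :
    valueCount Q ⊥ t = if t = 0 then 1 else 0 := by
  split_ifs with h
  · subst h
    exact valueCount_zero_of_anisotropic fun x hx _ => (Submodule.mem_bot F).1 hx
  · refine Nat.eq_zero_of_not_pos fun hpos => ?_
    obtain ⟨v, hv, hvt⟩ := valueCount_pos_iff.1 hpos
    rw [(Submodule.mem_bot F).1 hv, QuadraticMap.map_zero] at hvt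
    exact h hvt.symm

open scoped Classical in
/-- The value counts of a hyperbolic (`s = 1`) or elliptic (`s = -1`) space of dimension `2 m`. -/
def HasSignedCounts (Q : QuadraticForm F V) (U : Submodule F V) (m : ℕ) (s : ℤ) : Prop :=
  ∀ t, (Nat.card F : ℤ) * valueCount Q U t =
    (Nat.card F : ℤ) ^ (2 * m) +
      s * ((if t = 0 then (Nat.card F : ℤ) ^ (m + 1) else 0) - (Nat.card F : ℤ) ^ m)

/-- Multiplying the counts by $q$ avoids the exponent $m-1$, so the inductions can start at the zero
space. -/
theorem hasSignedCounts_bot (Q : QuadraticForm F V) : HasSignedCounts Q ⊥ 0 1 := by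
  intro t
  rw [valueCount_bot]
  split_ifs <;> simp

theorem hasSignedCounts_of_anisotropic_plane (hU : IsNondegenerateOn Q U)
    (han : ∀ x ∈ U, Q x = 0 → x = 0) (hd : finrank F U = 2) : HasSignedCounts Q U 1 (-1) := by
  intro t
  split_ifs with h
  · subst h
    rw [valueCount_zero_of_anisotropic han]
    push_cast
    ring
  · rw [valueCount_of_anisotropic_plane hU han hd h]
    push_cast
    ring

theorem IsHyperbolicPair.cast_valueCount {e f : V} {W : Submodule F V}
    (h : IsHyperbolicPair Q e f) (he : ∀ w ∈ W, polar Q e w = 0) (hf : ∀ w ∈ W, polar Q f w = 0)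
    (t : F) : (valueCount Q (hyperbolicSum e f W) t : ℤ) =
      ((Nat.card F : ℤ) - 1) * (Nat.card F : ℤ) ^ finrank F W + Nat.card F * valueCount Q W t := by
  rw [h.valueCount_hyperbolicSum he hf, Nat.cast_add, Nat.cast_mul, Nat.cast_mul,
    Nat.cast_sub one_lt_natCard.le]
  push_cast
  ring

theorem IsHyperbolicPair.hasSignedCounts {e f : V} {W : Submodule F V} {m : ℕ} {s : ℤ}
    (h : IsHyperbolicPair Q e f) (he : ∀ w ∈ W, polar Q e w = 0) (hf : ∀ w ∈ W, polar Q f w = 0)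
    (hd : finrank F W = 2 * m) (hW : HasSignedCounts Q W m s) :
    HasSignedCounts Q (hyperbolicSum e f W) (m + 1) s := by
  intro t
  rw [h.cast_valueCount he hf, hd, mul_add, hW t]
  split_ifs <;> ring

/-- Values are counted in even dimension according to a sign. -/
theorem exists_hasSignedCounts (m : ℕ) : ∀ {U : Submodule F V}, IsNondegenerateOn Q U →
    finrank F U = 2 * m → ∃ s : ℤ, (s = 1 ∨ s = -1) ∧ HasSignedCounts Q U m s := by
  induction m with
  | zero =>
    intro U hU hd
    rw [mul_zero, Submodule.finrank_eq_zero] at hd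
    subst hd
    exact ⟨1, Or.inl rfl, hasSignedCounts_bot Q⟩
  | succ m ih =>
    intro U hU hd
    by_cases han : ∀ x ∈ U, Q x = 0 → x = 0
    · have := finrank_le_two_of_anisotropic hU han
      obtain rfl : m = 0 := by omega
      exact ⟨-1, Or.inr rfl, hasSignedCounts_of_anisotropic_plane hU han hd⟩
    · push Not at han
      obtain ⟨e, heU, he, he0⟩ := han
      obtain ⟨f, hfU, W, hWU, h, hWe, hWf, hW, rfl⟩ := hU.exists_hyperbolicSum heU he0 he
      rw [h.finrank_hyperbolicSum hWe hWf] at hd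
      obtain ⟨s, hs, hsc⟩ := ih hW (by omega)
      exact ⟨s, hs, h.hasSignedCounts hWe hWf (by omega) hsc⟩

/-- The value counts of a space of odd dimension `2 m + 1`. -/
theorem valueCount_odd (m : ℕ) : ∀ {U : Submodule F V}, IsNondegenerateOn Q U →
    finrank F U = 2 * m + 1 → (valueCount Q U 0 : ℤ) = (Nat.card F : ℤ) ^ (2 * m) ∧
      ∀ t ≠ 0, (valueCount Q U t : ℤ) = (Nat.card F : ℤ) ^ (2 * m) + (Nat.card F : ℤ) ^ m ∨
        (valueCount Q U t : ℤ) = (Nat.card F : ℤ) ^ (2 * m) - (Nat.card F : ℤ) ^ m := by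
  induction m with
  | zero =>
    intro U hU hd
    have han : ∀ x ∈ U, Q x = 0 → x = 0 := by
      intro e heU he
      by_contra he0
      obtain ⟨f, hfU, W, hWU, h, hWe, hWf, hW, rfl⟩ := hU.exists_hyperbolicSum heU he0 he
      rw [h.finrank_hyperbolicSum hWe hWf] at hd
      omega
    refine ⟨by simp [valueCount_zero_of_anisotropic han], fun t ht => ?_⟩
    have := valueCount_ne_zero_of_anisotropic hU han ht
    rw [hd] at this
    rcases this with h | h
    · exact Or.inr (by simp [h])
    · exact Or.inl (by simp [h])
  | succ m ih =>
    intro U hU hd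
    by_cases han : ∀ x ∈ U, Q x = 0 → x = 0
    · have := finrank_le_two_of_anisotropic hU han
      omega
    · push Not at han
      obtain ⟨e, heU, he, he0⟩ := han
      obtain ⟨f, hfU, W, hWU, h, hWe, hWf, hW, rfl⟩ := hU.exists_hyperbolicSum heU he0 he
      rw [h.finrank_hyperbolicSum hWe hWf] at hd
      have hWd : finrank F W = 2 * m + 1 := by omega
      obtain ⟨h0, ht⟩ := ih hW hWd
      refine ⟨?_, fun t htne => ?_⟩
      · rw [h.cast_valueCount hWe hWf, hWd, h0]
        ring
      · rw [h.cast_valueCount hWe hWf, hWd]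
        rcases ht t htne with h1 | h1
        · exact Or.inl (by rw [h1]; ring)
        · exact Or.inr (by rw [h1]; ring)

/-- A space of dimension `2 m` with a totally singular subspace of dimension `m` is counted with
sign `1`. -/
theorem hasSignedCounts_of_totallySingular (m : ℕ) : ∀ {U T : Submodule F V},
    IsNondegenerateOn Q U → finrank F U = 2 * m → T ≤ U → (∀ x ∈ T, Q x = 0) →
      m ≤ finrank F T → HasSignedCounts Q U m 1 := by
  induction m with
  | zero =>
    intro U T _ hd _ _ _
    rw [mul_zero, Submodule.finrank_eq_zero] at hd
    subst hd
    exact hasSignedCounts_bot Q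
  | succ m ih =>
    intro U T hU hd hTU hT hTd
    obtain ⟨e, heT, he0⟩ := T.exists_mem_ne_zero_of_ne_bot (by
      rintro rfl
      simp at hTd)
    obtain ⟨f, hfU, W, hWU, h, hWe, hWf, hW, rfl⟩ :=
      hU.exists_hyperbolicSum (hTU heT) he0 (hT e heT)
    rw [h.finrank_hyperbolicSum hWe hWf] at hd
    have hTe : ∀ x ∈ T, polar Q e x = 0 := fun x hx => by
      rw [polar, hT _ (T.add_mem heT hx), hT e heT, hT x hx]
      simp
    -- `T` is orthogonal to `e`, so its hyperplane orthogonal to `f` lies in `W` and serves as the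
    -- totally singular subspace there.
    let φ : Module.Dual F T := (polarBilin Q f).comp T.subtype
    have hφ : φ ≠ 0 := fun h0 => by
      have := LinearMap.congr_fun h0 ⟨e, heT⟩
      have h1 : φ ⟨e, heT⟩ = 1 := h.polar_eq_one'
      rw [h1] at this
      simp at this
    have hker := Module.Dual.finrank_ker_add_one_of_ne_zero hφ
    have hfin : finrank F ((LinearMap.ker φ).map T.subtype) = finrank F (LinearMap.ker φ) :=
      LinearEquiv.finrank_eq (Submodule.equivMapOfInjective _ T.subtype_injective _).symm
    refine h.hasSignedCounts hWe hWf (by omega)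
      (ih (T := (LinearMap.ker φ).map T.subtype) hW (by omega) ?_ ?_ (by omega))
    · rintro - ⟨⟨x, hxT⟩, hx, rfl⟩
      have hfx : polar Q f x = 0 := hx
      obtain ⟨a, b, w, hw, hxw⟩ := mem_hyperbolicSum.1 (hTU hxT)
      have hb := h.polar_left a b (hWe w hw)
      have ha := h.polar_right a b (hWf w hw)
      rw [← hxw, hTe x hxT] at hb
      rw [← hxw, hfx] at ha
      subst ha hb
      simpa [hxw] using hw
    · rintro - ⟨⟨x, hxT⟩, -, rfl⟩
      exact hT x hxT

end Values

/-! ### Reflections and Witt's theorem for vectors. -/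

section Transitivity

variable {F : Type*} [Field F] {V : Type*} [AddCommGroup V] [Module F V] {Q : QuadraticForm F V}

/-- The linear map underlying the reflection in `w`. -/
def reflectionMap (Q : QuadraticForm F V) (w : V) : V →ₗ[F] V :=
  LinearMap.id - (LinearMap.toSpanSingleton F V w).comp ((Q w)⁻¹ • polarBilin Q w)

theorem reflectionMap_apply (w x : V) :
    reflectionMap Q w x = x - ((Q w)⁻¹ * polar Q w x) • w := rfl

theorem map_reflectionMap {w : V} (hw : Q w ≠ 0) (x : V) : Q (reflectionMap Q w x) = Q x := by
  rw [reflectionMap_apply, map_sub_eq, map_smul_eq, polar_smul_right, polar_comm (⇑Q) x w,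
    smul_eq_mul]
  field_simp
  ring

theorem reflectionMap_involutive {w : V} (hw : Q w ≠ 0) :
    Function.Involutive (reflectionMap Q w) := by
  intro x
  simp only [reflectionMap_apply, polar_sub_right, polar_smul_right, polar_self_eq, smul_eq_mul]
  rw [sub_sub, ← add_smul, sub_eq_self]
  convert zero_smul F w using 2
  field_simp
  ring

/-- The reflection in a nonsingular vector. -/
def reflection {w : V} (hw : Q w ≠ 0) : V ≃ₗ[F] V :=
  LinearEquiv.ofInvolutive (reflectionMap Q w) (reflectionMap_involutive hw)

theorem reflection_apply {w : V} (hw : Q w ≠ 0) (x : V) :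
    reflection hw x = x - ((Q w)⁻¹ * polar Q w x) • w := rfl

theorem map_reflection {w : V} (hw : Q w ≠ 0) (x : V) : Q (reflection hw x) = Q x :=
  map_reflectionMap hw x

/-- The reflection in $u-v$ works, because $\beta(u-v,u)=Q(u-v)$ when $Q(u)=Q(v)$. -/
theorem exists_isometry_of_map_sub_ne_zero {u v : V} (huv : Q u = Q v) (h : Q (u - v) ≠ 0) :
    ∃ g : V ≃ₗ[F] V, (∀ x, Q (g x) = Q x) ∧ g u = v := by
  refine ⟨reflection h, map_reflection h, ?_⟩
  have h1 : polar Q (u - v) u = Q (u - v) := by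
    rw [map_sub_eq, polar_sub_left, polar_self_eq, polar_comm (⇑Q) v u, huv]
    ring
  rw [reflection_apply, h1, inv_mul_cancel₀ h, one_smul, sub_sub_cancel]

theorem exists_polar_ne_zero_of_pair (hQ : IsNondegenerate Q) {u v : V} (hu : u ≠ 0)
    (hv : v ≠ 0) : ∃ x, polar Q u x ≠ 0 ∧ polar Q v x ≠ 0 := by
  rw [isNondegenerate_iff] at hQ
  obtain ⟨a, -, ha⟩ := hQ.exists_polar_ne_zero Submodule.mem_top hu
  obtain ⟨b, -, hb⟩ := hQ.exists_polar_ne_zero Submodule.mem_top hv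
  by_cases h1 : polar Q v a = 0
  · by_cases h2 : polar Q u b = 0
    · exact ⟨a + b, by simp [polar_add_right, h2, ha], by simp [polar_add_right, h1, hb]⟩
    · exact ⟨b, h2, hb⟩
  · exact ⟨a, ha, h1⟩

omit [Field F] in
theorem exists_ne_ne [Finite F] (hq : 3 ≤ Nat.card F) (a b : F) : ∃ c, c ≠ a ∧ c ≠ b := by
  classical
  have : Fintype F := Fintype.ofFinite F
  by_contra! h
  have : (Finset.univ : Finset F) ⊆ {a, b} := fun c _ => by
    rw [Finset.mem_insert, Finset.mem_singleton]
    exact or_iff_not_imp_left.2 (h c)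
  have := (Finset.card_le_card this).trans Finset.card_le_two
  rw [Finset.card_univ, ← Nat.card_eq_fintype_card] at this
  omega

/-- Suppose every vector outside $u^\perp\cup v^\perp$ is singular. For such $x$, the vector
$x+(u-v)$ is again outside, and comparing values gives $\beta(u-v,x)=0$. These $x$ span $V$, so
$u-v$ would be in the radical. -/
theorem exists_nonsingular_polar_ne_zero [Finite F] (hq : 3 ≤ Nat.card F)
    (hQ : IsNondegenerate Q) {u v : V} (hu : u ≠ 0) (hv : v ≠ 0) (huv : u ≠ v) (hQuv : Q u = Q v)
    (h : Q (u - v) = 0) : ∃ x, Q x ≠ 0 ∧ polar Q u x ≠ 0 ∧ polar Q v x ≠ 0 := by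
  by_contra! hall
  obtain ⟨c, hc0, hc1⟩ := exists_ne_ne hq (0 : F) 1
  have hpuv : polar Q u v = 2 * Q v := by
    rw [map_sub_eq, hQuv] at h
    linear_combination -h
  have huz : polar Q u (u - v) = 0 := by
    rw [polar_sub_right, polar_self_eq, hpuv, hQuv, sub_self]
  have hvz : polar Q v (u - v) = 0 := by
    rw [polar_sub_right, polar_self_eq, polar_comm (⇑Q) v, hpuv, sub_self]
  have hz : ∀ x, polar Q u x ≠ 0 → polar Q v x ≠ 0 → polar Q (u - v) x = 0 := by
    intro x hux hvx
    have h0 : Q x = 0 := by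
      by_contra h0
      exact hvx (hall x h0 hux)
    have h1 : Q (x + (u - v)) = 0 := by
      by_contra h1
      refine hvx ?_
      rw [← hall _ h1 ?_, polar_add_right, hvz, add_zero]
      rwa [polar_add_right, huz, add_zero]
    rwa [map_add_eq, h0, h, zero_add, zero_add, polar_comm] at h1
  obtain ⟨x₀, hux, hvx⟩ := exists_polar_ne_zero_of_pair hQ hu hv
  refine huv (sub_eq_zero.1 ((nondegenerate_polarBilin_iff Q).1 hQ _ fun y => ?_))
  -- At most two scalars put $y+ax_0$ into $u^\perp$ or $v^\perp$; $q\ge3$ leaves another one.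
  obtain ⟨a, ha1, ha2⟩ := exists_ne_ne hq (-(polar Q u y / polar Q u x₀))
    (-(polar Q v y / polar Q v x₀))
  have hy := hz (y + a • x₀)
    (by
      rw [polar_add_right, polar_smul_right, smul_eq_mul]
      intro h0
      apply ha1
      field_simp
      linear_combination h0)
    (by
      rw [polar_add_right, polar_smul_right, smul_eq_mul]
      intro h0
      apply ha2
      field_simp
      linear_combination h0)
  rwa [polar_add_right, polar_smul_right, hz x₀ hux hvx, smul_zero, add_zero] at hy

/-- Witt's theorem for vectors: isometries act transitively on the non-zero vectors on which `Q`
takes a given value. -/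
theorem exists_isometry_map_eq [Finite F] (hq : 3 ≤ Nat.card F) (hQ : IsNondegenerate Q) {u v : V}
    (hu : u ≠ 0) (hv : v ≠ 0) (huv : Q u = Q v) :
    ∃ g : V ≃ₗ[F] V, (∀ x, Q (g x) = Q x) ∧ g u = v := by
  by_cases heq : u = v
  · exact ⟨LinearEquiv.refl F V, fun _ => rfl, heq⟩
  by_cases h : Q (u - v) = 0
  · obtain ⟨x, hx, hux, hvx⟩ := exists_nonsingular_polar_ne_zero hq hQ hu hv heq huv h
    -- After reflecting $u$ in $x$ the difference has value $\beta(u,x)\beta(v,x)/Q(x)$, so a second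
    -- reflection finishes.
    have h1 : Q (reflection hx u - v) ≠ 0 := by
      have hpuv : polar Q u v = 2 * Q v := by
        rw [map_sub_eq, huv] at h
        linear_combination -h
      rw [map_sub_eq, map_reflection, reflection_apply, polar_sub_left, polar_smul_left, hpuv, huv,
        polar_comm (⇑Q) x u, polar_comm (⇑Q) x v, smul_eq_mul]
      have : (Q x)⁻¹ * polar Q u x * polar Q v x ≠ 0 :=
        mul_ne_zero (mul_ne_zero (inv_ne_zero hx) hux) hvx
      intro h0
      apply this
      linear_combination h0
    obtain ⟨g, hg, hgu⟩ := exists_isometry_of_map_sub_ne_zero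
      ((map_reflection hx u).trans huv) h1
    exact ⟨(reflection hx).trans g, fun y => by simp [hg, map_reflection], hgu⟩
  · exact exists_isometry_of_map_sub_ne_zero huv h

end Transitivity

/-! ### Non-zero vectors of given value, and the expected number of common vectors. -/

section PairSum

variable {F : Type*} [Field F] {V : Type*} [AddCommGroup V] [Module F V]

/-- The number of non-zero vectors of `U` on which `Q` takes the value `t`. -/
def nonzeroCount (Q : QuadraticForm F V) (U : Submodule F V) (t : F) : ℕ :=
  Nat.card {v : V // v ∈ U ∧ v ≠ 0 ∧ Q v = t}

variable {Q : QuadraticForm F V} {U U' : Submodule F V}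

theorem nonzeroCount_of_ne_zero {t : F} (ht : t ≠ 0) : nonzeroCount Q U t = valueCount Q U t := by
  refine Nat.card_congr (Equiv.subtypeEquivRight fun v => ?_)
  constructor
  · exact fun h => ⟨h.1, h.2.2⟩
  · rintro ⟨h, rfl⟩
    refine ⟨h, ?_, rfl⟩
    rintro rfl
    simp at ht

variable [Finite F] [Module.Finite F V]

theorem nonzeroCount_zero_add_one : nonzeroCount Q U 0 + 1 = valueCount Q U 0 := by
  classical
  have : Finite V := Module.finite_of_finite F
  let _ : Unique {x : V // (x ∈ U ∧ Q x = 0) ∧ x = 0} :=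
    ⟨⟨⟨0, ⟨U.zero_mem, QuadraticMap.map_zero Q⟩, rfl⟩⟩, fun x => Subtype.ext x.2.2⟩
  rw [nonzeroCount, ← Nat.card_unique (α := {x : V // (x ∈ U ∧ Q x = 0) ∧ x = 0}), ← Nat.card_sum,
    valueCount]
  refine (Nat.card_congr ⟨fun w => if h : w.1 = 0 then Sum.inr ⟨w, w.2, h⟩ else
    Sum.inl ⟨w, w.2.1, h, w.2.2⟩,
    Sum.elim (fun w => ⟨w, w.2.1, w.2.2.2⟩) (fun w => ⟨w, w.2.1⟩), ?_, ?_⟩).symm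
  · intro w
    by_cases h : w.1 = 0
    · simpa [h] using Subtype.ext h.symm
    · simp [h]
  · rintro (⟨w, hw⟩ | ⟨w, hw⟩)
    · simp [hw.2.1]
    · simp [hw.2]

omit [Finite F] [Module.Finite F V] in
theorem HasSignedCounts.mul_nonzeroCount_of_ne_zero {m : ℕ} {s : ℤ} (h : HasSignedCounts Q U m s)
    {t : F} (ht : t ≠ 0) : (Nat.card F : ℤ) * nonzeroCount Q U t =
      (Nat.card F : ℤ) ^ (2 * m) - s * (Nat.card F : ℤ) ^ m := by
  rw [nonzeroCount_of_ne_zero ht, h t, if_neg ht]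
  ring

theorem HasSignedCounts.mul_nonzeroCount_zero {m : ℕ} {s : ℤ} (h : HasSignedCounts Q U m s) :
    (Nat.card F : ℤ) * nonzeroCount Q U 0 = (Nat.card F : ℤ) ^ (2 * m) +
      s * ((Nat.card F : ℤ) ^ (m + 1) - (Nat.card F : ℤ) ^ m) - Nat.card F := by
  have h0 := h 0
  rw [if_pos rfl, ← nonzeroCount_zero_add_one] at h0
  push_cast at h0
  linear_combination h0

theorem nonzeroCount_odd_zero (hU : IsNondegenerateOn Q U) {m : ℕ}
    (hd : finrank F U = 2 * m + 1) :
    (nonzeroCount Q U 0 : ℤ) = (Nat.card F : ℤ) ^ (2 * m) - 1 := by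
  have h0 := (valueCount_odd m hU hd).1
  rw [← nonzeroCount_zero_add_one] at h0
  push_cast at h0
  linear_combination h0

theorem nonzeroCount_odd_bounds (hU : IsNondegenerateOn Q U) {m : ℕ}
    (hd : finrank F U = 2 * m + 1) {t : F} (ht : t ≠ 0) :
    (Nat.card F : ℤ) ^ (2 * m) - (Nat.card F : ℤ) ^ m ≤ nonzeroCount Q U t ∧
      (nonzeroCount Q U t : ℤ) ≤ (Nat.card F : ℤ) ^ (2 * m) + (Nat.card F : ℤ) ^ m := by
  have hx : 0 < (Nat.card F : ℤ) ^ m := pow_pos (by exact_mod_cast Nat.card_pos) _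
  rw [nonzeroCount_of_ne_zero ht]
  rcases (valueCount_odd m hU hd).2 t ht with h | h <;> rw [h] <;> constructor <;> linarith

theorem nonzeroCount_even_bounds (hU : IsNondegenerateOn Q U) {m : ℕ}
    (hd : finrank F U = 2 * m) {t : F} (ht : t ≠ 0) :
    (Nat.card F : ℤ) ^ (2 * m) - (Nat.card F : ℤ) ^ m ≤ Nat.card F * nonzeroCount Q U t ∧
      (Nat.card F : ℤ) * nonzeroCount Q U t ≤
        (Nat.card F : ℤ) ^ (2 * m) + (Nat.card F : ℤ) ^ m := by
  have hx : 0 < (Nat.card F : ℤ) ^ m := pow_pos (by exact_mod_cast Nat.card_pos) _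
  obtain ⟨s, rfl | rfl, h⟩ := exists_hasSignedCounts m hU hd <;>
    rw [h.mul_nonzeroCount_of_ne_zero ht] <;> constructor <;> linarith

theorem nonzeroCount_even_zero_bounds (hU : IsNondegenerateOn Q U) {m : ℕ}
    (hd : finrank F U = 2 * m) :
    (Nat.card F : ℤ) ^ (2 * m) - ((Nat.card F : ℤ) ^ (m + 1) - (Nat.card F : ℤ) ^ m) - Nat.card F ≤
        Nat.card F * nonzeroCount Q U 0 ∧
      (Nat.card F : ℤ) * nonzeroCount Q U 0 ≤ (Nat.card F : ℤ) ^ (2 * m) +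
        ((Nat.card F : ℤ) ^ (m + 1) - (Nat.card F : ℤ) ^ m) - Nat.card F := by
  have hx : 0 < (Nat.card F : ℤ) ^ m := pow_pos (by exact_mod_cast Nat.card_pos) _
  have hq : 1 < (Nat.card F : ℤ) := by exact_mod_cast one_lt_natCard
  obtain ⟨s, rfl | rfl, h⟩ := exists_hasSignedCounts m hU hd <;>
    rw [h.mul_nonzeroCount_zero, pow_succ] <;> constructor <;> nlinarith

/-- The count exceeds $q^{d-1}$, $d=\dim U$, by at most a third. The value 0 on planes is left out
because a hyperbolic plane has $2(q-1)$ non-zero singular vectors. -/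
theorem three_mul_nonzeroCount_le (hq : 3 ≤ Nat.card F) (hU : IsNondegenerateOn Q U)
    (hd : 2 ≤ finrank F U) {t : F} (ht : t ≠ 0 ∨ 3 ≤ finrank F U) :
    3 * ((Nat.card F : ℤ) * nonzeroCount Q U t) ≤ 4 * (Nat.card F : ℤ) ^ finrank F U := by
  have hq' : (3 : ℤ) ≤ Nat.card F := by exact_mod_cast hq
  set q : ℤ := (Nat.card F : ℤ)
  obtain ⟨m, hm | hm⟩ := Nat.even_or_odd' (finrank F U)
  · obtain ⟨k, rfl⟩ := Nat.exists_eq_add_of_le' (by omega : 1 ≤ m)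
    have hx : 1 ≤ q ^ k := one_le_pow₀ (by linarith)
    have e1 : q ^ (2 * (k + 1)) = q ^ 2 * (q ^ k) ^ 2 := by ring
    have e2 : q ^ (k + 1) = q * q ^ k := by ring
    have e3 : q ^ (k + 1 + 1) = q ^ 2 * q ^ k := by ring
    by_cases h0 : t = 0
    · subst h0
      have hk : 1 ≤ k := by
        rcases ht with h | h
        · exact absurd rfl h
        · omega
      have hx3 : 3 ≤ q ^ k := hq'.trans (le_self_pow₀ (by linarith) (by omega))
      have h := (nonzeroCount_even_zero_bounds hU hm).2
      rw [hm, e1]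
      change q * _ ≤ q ^ (2 * (k + 1)) + (q ^ (k + 1 + 1) - q ^ (k + 1)) - q at h
      rw [e1, e2, e3] at h
      have : 0 ≤ q ^ 2 * (q ^ k) * (q ^ k - 3) := by
        have : 0 ≤ q ^ k - 3 := by linarith
        positivity
      have : 0 ≤ q * q ^ k := by positivity
      nlinarith
    · have h := (nonzeroCount_even_bounds hU hm h0).2
      rw [hm, e1]
      change q * _ ≤ q ^ (2 * (k + 1)) + q ^ (k + 1) at h
      rw [e1, e2] at h
      have hqx : 3 ≤ q * q ^ k := by nlinarith
      nlinarith
  · obtain ⟨k, rfl⟩ := Nat.exists_eq_add_of_le' (by omega : 1 ≤ m)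
    have hx : 3 ≤ q ^ (k + 1) := hq'.trans (le_self_pow₀ (by linarith) (by omega))
    have e1 : q ^ (2 * (k + 1)) = (q ^ (k + 1)) ^ 2 := by ring
    have e2 : q ^ (2 * (k + 1) + 1) = q * (q ^ (k + 1)) ^ 2 := by ring
    have hle : 3 * (nonzeroCount Q U t : ℤ) ≤ 4 * (q ^ (k + 1)) ^ 2 := by
      by_cases h0 : t = 0
      · subst h0
        rw [nonzeroCount_odd_zero hU hm]
        change 3 * (q ^ (2 * (k + 1)) - 1) ≤ _
        rw [e1]
        nlinarith
      · have h := (nonzeroCount_odd_bounds hU hm h0).2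
        change _ ≤ q ^ (2 * (k + 1)) + q ^ (k + 1) at h
        rw [e1] at h
        nlinarith
    rw [hm, e2]
    nlinarith

/-- The relative deficit from $q^{d-1}$, $d=\dim U$, is at most $1/9$, as $q^2\ge9$. The value 0 in
dimension 4 is left out because an elliptic space has relative deficit about $1/q$. -/
theorem le_nine_mul_nonzeroCount (hq : 3 ≤ Nat.card F) (hU : IsNondegenerateOn Q U)
    (hd : 4 ≤ finrank F U) {t : F} (ht : t ≠ 0 ∨ 5 ≤ finrank F U) :
    8 * (Nat.card F : ℤ) ^ finrank F U ≤ 9 * ((Nat.card F : ℤ) * nonzeroCount Q U t) := by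
  have hq' : (3 : ℤ) ≤ Nat.card F := by exact_mod_cast hq
  set q : ℤ := (Nat.card F : ℤ)
  have hq2 : 9 ≤ q ^ 2 := by nlinarith
  obtain ⟨m, hm | hm⟩ := Nat.even_or_odd' (finrank F U)
  · obtain ⟨k, rfl⟩ := Nat.exists_eq_add_of_le' (by omega : 2 ≤ m)
    have hx : 1 ≤ q ^ k := one_le_pow₀ (by linarith)
    have hx9 : 9 ≤ q ^ 2 * q ^ k := by nlinarith
    have e1 : q ^ (2 * (k + 2)) = (q ^ 2 * q ^ k) ^ 2 := by ring
    have e2 : q ^ (k + 2) = q ^ 2 * q ^ k := by ring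
    have e3 : q ^ (k + 2 + 1) = q * (q ^ 2 * q ^ k) := by ring
    by_cases h0 : t = 0
    · subst h0
      have hk : 1 ≤ k := by
        rcases ht with h | h
        · exact absurd rfl h
        · omega
      have hx3 : 3 ≤ q ^ k := hq'.trans (le_self_pow₀ (by linarith) (by omega))
      have h := (nonzeroCount_even_zero_bounds hU hm).1
      rw [hm, e1]
      change q ^ (2 * (k + 2)) - (q ^ (k + 2 + 1) - q ^ (k + 2)) - q ≤ q * _ at h
      rw [e1, e2, e3] at h
      have h9 : 9 * q ≤ q ^ 2 * q ^ k := by nlinarith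
      have : 9 * q * (q ^ 2 * q ^ k) ≤ (q ^ 2 * q ^ k) ^ 2 := by nlinarith
      nlinarith
    · have h := (nonzeroCount_even_bounds hU hm h0).1
      rw [hm, e1]
      change q ^ (2 * (k + 2)) - q ^ (k + 2) ≤ q * _ at h
      rw [e1, e2] at h
      nlinarith
  · obtain ⟨k, rfl⟩ := Nat.exists_eq_add_of_le' (by omega : 2 ≤ m)
    have hx : 1 ≤ q ^ k := one_le_pow₀ (by linarith)
    have hx9 : 9 ≤ q ^ 2 * q ^ k := by nlinarith
    have e1 : q ^ (2 * (k + 2)) = (q ^ 2 * q ^ k) ^ 2 := by ring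
    have e2 : q ^ (k + 2) = q ^ 2 * q ^ k := by ring
    have e3 : q ^ (2 * (k + 2) + 1) = q * (q ^ 2 * q ^ k) ^ 2 := by ring
    have hle : 8 * (q ^ 2 * q ^ k) ^ 2 ≤ 9 * (nonzeroCount Q U t : ℤ) := by
      by_cases h0 : t = 0
      · subst h0
        rw [nonzeroCount_odd_zero hU hm]
        change _ ≤ 9 * (q ^ (2 * (k + 2)) - 1)
        rw [e1]
        nlinarith
      · have h := (nonzeroCount_odd_bounds hU hm h0).1
        change q ^ (2 * (k + 2)) - q ^ (k + 2) ≤ _ at h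
        rw [e1, e2] at h
        nlinarith
    rw [hm, e3]
    nlinarith

variable [Fintype F]

omit [Finite F] in
theorem sum_nonzeroCount (Q : QuadraticForm F V) (U : Submodule F V) :
    ∑ t, nonzeroCount Q U t + 1 = Nat.card F ^ finrank F U := by
  classical
  rw [← sum_valueCount Q U, ← Finset.sum_erase_add _ _ (Finset.mem_univ (0 : F)),
    ← Finset.sum_erase_add (a := (0 : F)) (f := valueCount Q U) _ (Finset.mem_univ (0 : F)),
    ← nonzeroCount_zero_add_one, add_assoc]
  congr 1
  exact Finset.sum_congr rfl fun t ht => nonzeroCount_of_ne_zero (Finset.ne_of_mem_erase ht)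

/-- The expected number of common non-zero vectors of `U` and a random isometric image of `U'`. -/
def pairSum (Q : QuadraticForm F V) (U U' : Submodule F V) : ℚ :=
  ∑ t, (nonzeroCount Q U t : ℚ) * nonzeroCount Q U' t / nonzeroCount Q ⊤ t

omit [Finite F] [Module.Finite F V] in
theorem pairSum_comm (Q : QuadraticForm F V) (U U' : Submodule F V) :
    pairSum Q U U' = pairSum Q U' U :=
  Finset.sum_congr rfl fun _ _ => by rw [mul_comm (nonzeroCount Q U _ : ℚ)]

omit [Finite F] in
-- The value 0 behaves differently in small dimensions, so its term gets its own bound `A`. The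
-- other values share the ratio `B`, and their counts on `U` add up to $q^{\dim U}-1-N_U(0)$.
theorem pairSum_le {A B : ℚ} (hA : 0 ≤ A) (hB : 0 ≤ B)
    (h0 : (nonzeroCount Q U 0 : ℚ) * nonzeroCount Q U' 0 ≤ A * nonzeroCount Q ⊤ 0)
    (h1 : ∀ t ≠ 0, (nonzeroCount Q U' t : ℚ) ≤ B * nonzeroCount Q ⊤ t) :
    pairSum Q U U' ≤ A + B * ((Nat.card F : ℚ) ^ finrank F U - 1 - nonzeroCount Q U 0) := by
  classical
  have hsum : ((Nat.card F : ℚ) ^ finrank F U - 1 - nonzeroCount Q U 0) =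
      ∑ t ∈ Finset.univ.erase (0 : F), (nonzeroCount Q U t : ℚ) := by
    have := sum_nonzeroCount Q U
    rw [← Finset.sum_erase_add _ _ (Finset.mem_univ (0 : F))] at this
    have h' : (∑ t ∈ Finset.univ.erase (0 : F), (nonzeroCount Q U t : ℚ)) + nonzeroCount Q U 0 + 1
        = (Nat.card F : ℚ) ^ finrank F U := by exact_mod_cast this
    linarith
  rw [pairSum, ← Finset.sum_erase_add _ _ (Finset.mem_univ (0 : F)), hsum, Finset.mul_sum, add_comm]
  refine add_le_add (div_le_of_le_mul₀ (by positivity) hA h0) (Finset.sum_le_sum fun t ht => ?_)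
  refine div_le_of_le_mul₀ (by positivity) (by positivity) ?_
  have := h1 t (Finset.ne_of_mem_erase ht)
  have h2 : (0 : ℚ) ≤ nonzeroCount Q U t := by positivity
  nlinarith

end PairSum

/-! ### Bounding the expected number of common vectors. -/

section PairBounds

variable {F : Type*} [Field F] [Fintype F] {V : Type*} [AddCommGroup V] [Module F V]
  [Module.Finite F V] {Q : QuadraticForm F V} {U U' : Submodule F V}

theorem nonzeroCount_zero_of_finrank_eq_one (hU : IsNondegenerateOn Q U) (hd : finrank F U = 1) :
    nonzeroCount Q U 0 = 0 := by
  have := nonzeroCount_odd_zero hU (m := 0) (by omega)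
  simpa using this

/-- The ratio $N_{U'}(t)/N_V(t)$ is at most $\frac43\cdot\frac98\,q^{-\dim U}$, so the sum is at
most $3/2$, below $43/24\le\frac{43}{16q}(q-1)$. If $U$ is a line, the ratio at 0 is not needed,
since $N_U(0)=0$. -/
theorem pairSum_le_of_three_le (hq : 3 ≤ Nat.card F) (hV : IsNondegenerateOn Q ⊤)
    (hU : IsNondegenerateOn Q U) (hU' : IsNondegenerateOn Q U') (hn : 1 ≤ finrank F U)
    (hn' : 3 ≤ finrank F U') (hd : finrank F V = finrank F U + finrank F U') :
    pairSum Q U U' ≤ 43 / (16 * (Nat.card F : ℚ)) * (Nat.card F - 1) := by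
  have htop : finrank F (⊤ : Submodule F V) = finrank F U + finrank F U' := by
    rw [finrank_top, hd]
  have hq' : (3 : ℚ) ≤ Nat.card F := by exact_mod_cast hq
  have hqn : (1 : ℚ) ≤ (Nat.card F : ℚ) ^ finrank F U := one_le_pow₀ (by linarith)
  have ratio : ∀ t : F, (t ≠ 0 ∨ 2 ≤ finrank F U) → (nonzeroCount Q U' t : ℚ) ≤
      3 / 2 / (Nat.card F : ℚ) ^ finrank F U * nonzeroCount Q ⊤ t := by
    intro t ht
    have h1 := three_mul_nonzeroCount_le hq hU' (by omega) (t := t) (Or.inr hn')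
    have h2 := le_nine_mul_nonzeroCount hq hV (by omega) (t := t)
      (ht.imp id fun h => by omega)
    rw [htop, pow_add] at h2
    have h1' : 3 * ((Nat.card F : ℚ) * nonzeroCount Q U' t) ≤
      4 * (Nat.card F : ℚ) ^ finrank F U' := by exact_mod_cast h1
    have h2' : 8 * ((Nat.card F : ℚ) ^ finrank F U * (Nat.card F : ℚ) ^ finrank F U') ≤
      9 * ((Nat.card F : ℚ) * nonzeroCount Q ⊤ t) := by exact_mod_cast h2
    rw [div_mul_eq_mul_div, le_div_iff₀ (by linarith)]
    generalize (Nat.card F : ℚ) ^ finrank F U = x at *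
    generalize (Nat.card F : ℚ) ^ finrank F U' = y at *
    generalize (Nat.card F : ℚ) = q at *
    have h3 : q * (nonzeroCount Q U' t * x) ≤ q * (3 / 2 * nonzeroCount Q ⊤ t) := by
      nlinarith
    exact le_of_mul_le_mul_left h3 (by linarith)
  have h0 : (nonzeroCount Q U 0 : ℚ) * nonzeroCount Q U' 0 ≤
      3 / 2 / (Nat.card F : ℚ) ^ finrank F U * nonzeroCount Q U 0 * nonzeroCount Q ⊤ 0 := by
    rcases hn.eq_or_lt with h | h
    · simp [nonzeroCount_zero_of_finrank_eq_one hU h.symm]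
    · have := mul_le_mul_of_nonneg_left (ratio 0 (Or.inr h))
        (Nat.cast_nonneg (α := ℚ) (nonzeroCount Q U 0))
      linarith
  refine (pairSum_le (by positivity) (by positivity) h0 fun t ht => ratio t (Or.inl ht)).trans ?_
  have h3 : 3 / 2 / (Nat.card F : ℚ) ^ finrank F U * nonzeroCount Q U 0 +
      3 / 2 / (Nat.card F : ℚ) ^ finrank F U *
        ((Nat.card F : ℚ) ^ finrank F U - 1 - nonzeroCount Q U 0) ≤ 3 / 2 := by
    rw [← mul_add, div_mul_eq_mul_div, div_le_iff₀ (by linarith)]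
    linarith
  refine h3.trans ?_
  rw [div_mul_eq_mul_div, le_div_iff₀ (by linarith)]
  linarith

/-- The left side is the bound obtained for a line and a plane, and for two planes with `U`
elliptic. -/
theorem add_one_div_self_le {q : ℚ} (hq : 3 ≤ q) : (q + 1) / q ≤ 43 / (16 * q) * (q - 1) := by
  rw [div_mul_eq_mul_div, div_le_div_iff₀ (by linarith) (by linarith)]
  nlinarith

theorem pairSum_le_line_plane (hq : 3 ≤ Nat.card F) (hV : IsNondegenerateOn Q ⊤)
    (hU : IsNondegenerateOn Q U) (hU' : IsNondegenerateOn Q U') (hn : finrank F U = 1)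
    (hn' : finrank F U' = 2) (hd : finrank F V = 3) :
    pairSum Q U U' ≤ 43 / (16 * (Nat.card F : ℚ)) * (Nat.card F - 1) := by
  have hq' : (3 : ℚ) ≤ Nat.card F := by exact_mod_cast hq
  have h0 := nonzeroCount_zero_of_finrank_eq_one hU hn
  have ratio : ∀ t ≠ (0 : F), (nonzeroCount Q U' t : ℚ) ≤
      ((Nat.card F : ℚ) + 1) / (Nat.card F * (Nat.card F - 1)) * nonzeroCount Q ⊤ t := by
    intro t ht
    have h1 := (nonzeroCount_even_bounds hU' (m := 1) hn' ht).2
    have h2 := (nonzeroCount_odd_bounds hV (m := 1) (by rw [finrank_top, hd]) ht).1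
    have h1' : (Nat.card F : ℚ) * nonzeroCount Q U' t ≤ (Nat.card F : ℚ) ^ (2 * 1) +
      (Nat.card F : ℚ) ^ 1 := by exact_mod_cast h1
    have h2' : (Nat.card F : ℚ) ^ (2 * 1) - (Nat.card F : ℚ) ^ 1 ≤ nonzeroCount Q ⊤ t := by
      exact_mod_cast h2
    generalize (Nat.card F : ℚ) = q at *
    have h3 : (nonzeroCount Q U' t : ℚ) ≤ q + 1 :=
      le_of_mul_le_mul_left (by linear_combination h1') (by linarith : 0 < q)
    rw [div_mul_eq_mul_div, le_div_iff₀ (mul_pos (by linarith) (by linarith))]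
    exact mul_le_mul h3 (by linear_combination h2') (mul_nonneg (by linarith) (by linarith)) (by linarith)
  have hB : 0 ≤ ((Nat.card F : ℚ) + 1) / (Nat.card F * (Nat.card F - 1)) :=
    div_nonneg (by linarith) (mul_nonneg (by linarith) (by linarith))
  refine (pairSum_le le_rfl hB (by simp [h0]) ratio).trans ?_
  refine le_trans (le_of_eq ?_) (add_one_div_self_le hq')
  rw [h0, hn]
  have : (Nat.card F : ℚ) - 1 ≠ 0 := by linarith
  field_simp
  simp

theorem pairSum_le_plane_plane (hq : 3 ≤ Nat.card F) (hV : IsNondegenerateOn Q ⊤)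
    (hU : IsNondegenerateOn Q U) (hU' : IsNondegenerateOn Q U') (hn : finrank F U = 2)
    (hn' : finrank F U' = 2) (hd : finrank F V = 4) :
    pairSum Q U U' ≤ 43 / (16 * (Nat.card F : ℚ)) * (Nat.card F - 1) := by
  have hq' : (3 : ℚ) ≤ Nat.card F := by exact_mod_cast hq
  have ratio : ∀ t ≠ (0 : F), (nonzeroCount Q U' t : ℚ) ≤
      1 / ((Nat.card F : ℚ) * (Nat.card F - 1)) * nonzeroCount Q ⊤ t := by
    intro t ht
    have h1 := (nonzeroCount_even_bounds hU' (m := 1) hn' ht).2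
    have h2 := (nonzeroCount_even_bounds hV (m := 2) (by rw [finrank_top, hd]) ht).1
    have h1' : (Nat.card F : ℚ) * nonzeroCount Q U' t ≤ (Nat.card F : ℚ) ^ (2 * 1) +
      (Nat.card F : ℚ) ^ 1 := by exact_mod_cast h1
    have h2' : (Nat.card F : ℚ) ^ (2 * 2) - (Nat.card F : ℚ) ^ 2 ≤
      Nat.card F * nonzeroCount Q ⊤ t := by exact_mod_cast h2
    generalize (Nat.card F : ℚ) = q at *
    have h3 : (nonzeroCount Q U' t : ℚ) ≤ q + 1 :=
      le_of_mul_le_mul_left (by linear_combination h1') (by linarith : 0 < q)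
    have h4 : q ^ 3 - q ≤ (nonzeroCount Q ⊤ t : ℚ) :=
      le_of_mul_le_mul_left (by linear_combination h2') (by linarith : 0 < q)
    rw [div_mul_eq_mul_div, one_mul, le_div_iff₀ (mul_pos (by linarith) (by linarith))]
    have : 0 ≤ q * (q - 1) := mul_nonneg (by linarith) (by linarith)
    nlinarith
  have hB : 0 ≤ 1 / ((Nat.card F : ℚ) * (Nat.card F - 1)) :=
    div_nonneg (by linarith) (mul_nonneg (by linarith) (by linarith))
  -- The value 0 contributes only if `U` is hyperbolic. Its term is then estimated by taking $U'$
  -- hyperbolic and $V$ elliptic, the extreme counts.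
  obtain ⟨s, rfl | rfl, hs⟩ := exists_hasSignedCounts 1 hU hn
  · have hc0 : (nonzeroCount Q U 0 : ℚ) = 2 * (Nat.card F - 1) := by
      have h : (Nat.card F : ℚ) * nonzeroCount Q U 0 = (Nat.card F : ℚ) ^ (2 * 1) +
        1 * ((Nat.card F : ℚ) ^ (1 + 1) - (Nat.card F : ℚ) ^ 1) - Nat.card F := by
          exact_mod_cast hs.mul_nonzeroCount_zero
      exact mul_left_cancel₀ (by linarith : (Nat.card F : ℚ) ≠ 0) (by linear_combination h)
    have h0 : (nonzeroCount Q U 0 : ℚ) * nonzeroCount Q U' 0 ≤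
        4 * (Nat.card F - 1) / ((Nat.card F : ℚ) ^ 2 + 1) * nonzeroCount Q ⊤ 0 := by
      have h1 := (nonzeroCount_even_zero_bounds hU' (m := 1) hn').2
      have h2 := (nonzeroCount_even_zero_bounds hV (m := 2) (by rw [finrank_top, hd])).1
      have h1' : (Nat.card F : ℚ) * nonzeroCount Q U' 0 ≤ (Nat.card F : ℚ) ^ (2 * 1) +
        ((Nat.card F : ℚ) ^ (1 + 1) - (Nat.card F : ℚ) ^ 1) - Nat.card F := by exact_mod_cast h1
      have h2' : (Nat.card F : ℚ) ^ (2 * 2) -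
          ((Nat.card F : ℚ) ^ (2 + 1) - (Nat.card F : ℚ) ^ 2) - Nat.card F ≤
        Nat.card F * nonzeroCount Q ⊤ 0 := by exact_mod_cast h2
      rw [hc0]
      generalize (Nat.card F : ℚ) = q at *
      have h3 : (nonzeroCount Q U' 0 : ℚ) ≤ 2 * (q - 1) :=
        le_of_mul_le_mul_left (by linear_combination h1') (by linarith : 0 < q)
      have h4 : (q - 1) * (q ^ 2 + 1) ≤ (nonzeroCount Q ⊤ 0 : ℚ) :=
        le_of_mul_le_mul_left (by linear_combination h2') (by linarith : 0 < q)
      rw [div_mul_eq_mul_div, le_div_iff₀ (by positivity)]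
      calc 2 * (q - 1) * (nonzeroCount Q U' 0 : ℚ) * (q ^ 2 + 1)
          ≤ 2 * (q - 1) * (2 * (q - 1)) * (q ^ 2 + 1) := by
            have : 0 ≤ q - 1 := by linarith
            gcongr
        _ = 4 * (q - 1) * ((q - 1) * (q ^ 2 + 1)) := by ring
        _ ≤ 4 * (q - 1) * (nonzeroCount Q ⊤ 0 : ℚ) :=
            mul_le_mul_of_nonneg_left h4 (by linarith)
    have hA : 0 ≤ 4 * (Nat.card F - 1) / ((Nat.card F : ℚ) ^ 2 + 1) :=
      div_nonneg (by linarith) (by positivity)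
    refine (pairSum_le hA hB h0 ratio).trans ?_
    rw [hc0, hn]
    generalize (Nat.card F : ℚ) = q at *
    have hq1 : q - 1 ≠ 0 := by linarith
    have e1 : 4 * (q - 1) / (q ^ 2 + 1) + 1 / (q * (q - 1)) * (q ^ 2 - 1 - 2 * (q - 1)) =
        (4 / (q ^ 2 + 1) + 1 / q) * (q - 1) := by
      field_simp
      ring
    rw [e1]
    refine mul_le_mul_of_nonneg_right ?_ (by linarith)
    have h27 : 4 / (q ^ 2 + 1) ≤ 27 / (16 * q) := by
      rw [div_le_div_iff₀ (by positivity) (by linarith)]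
      nlinarith
    have e2 : 43 / (16 * q) = 27 / (16 * q) + 1 / q := by
      field_simp
      norm_num
    linarith
  · have hc0 : (nonzeroCount Q U 0 : ℚ) = 0 := by
      have h : (Nat.card F : ℚ) * nonzeroCount Q U 0 = (Nat.card F : ℚ) ^ (2 * 1) +
        (-1) * ((Nat.card F : ℚ) ^ (1 + 1) - (Nat.card F : ℚ) ^ 1) - Nat.card F := by
          exact_mod_cast hs.mul_nonzeroCount_zero
      exact mul_left_cancel₀ (by linarith : (Nat.card F : ℚ) ≠ 0) (by linear_combination h)
    refine (pairSum_le le_rfl hB (by simp [hc0]) ratio).trans ?_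
    refine le_trans (le_of_eq ?_) (add_one_div_self_le hq')
    rw [hc0, hn]
    have : (Nat.card F : ℚ) - 1 ≠ 0 := by linarith
    field_simp
    ring

/-- Here $N_{U'}(t)\le2$ and $N_V(t)=q-s$ for $t\ne0$, so what is needed is $32q\le43(q-s)$. For
$s=1$ this fails at $q=3$ and reads $128\le129$ at $q=4$: this case decides the constant 43 and the
exception. -/
theorem pairSum_le_line_line (hq : 3 ≤ Nat.card F) (hV : IsNondegenerateOn Q ⊤)
    (hU : IsNondegenerateOn Q U) (hU' : IsNondegenerateOn Q U') (hn : finrank F U = 1)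
    (hn' : finrank F U' = 1) (hd : finrank F V = 2)
    (hex : ¬ (Nat.card F = 3 ∧ HasSignedCounts Q (⊤ : Submodule F V) 1 1)) :
    pairSum Q U U' ≤ 43 / (16 * (Nat.card F : ℚ)) * (Nat.card F - 1) := by
  have hq' : (3 : ℚ) ≤ Nat.card F := by exact_mod_cast hq
  have h0 := nonzeroCount_zero_of_finrank_eq_one hU hn
  obtain ⟨s, hs, hsc⟩ := exists_hasSignedCounts 1 hV (by rw [finrank_top, hd])
  have hpos : 0 < (Nat.card F : ℚ) - s := by
    rcases hs with rfl | rfl <;> push_cast <;> linarith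
  have ratio : ∀ t ≠ (0 : F), (nonzeroCount Q U' t : ℚ) ≤
      2 / ((Nat.card F : ℚ) - s) * nonzeroCount Q ⊤ t := by
    intro t ht
    have h1 : (nonzeroCount Q U' t : ℚ) ≤ (Nat.card F : ℚ) ^ (2 * 0) + (Nat.card F : ℚ) ^ 0 := by
      exact_mod_cast (nonzeroCount_odd_bounds hU' (m := 0) (by omega) ht).2
    have h2 : (Nat.card F : ℚ) * nonzeroCount Q ⊤ t = (Nat.card F : ℚ) ^ (2 * 1) -
        s * (Nat.card F : ℚ) ^ 1 := by
      exact_mod_cast hsc.mul_nonzeroCount_of_ne_zero ht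
    have h3 : (nonzeroCount Q ⊤ t : ℚ) = Nat.card F - s :=
      mul_left_cancel₀ (by linarith : (Nat.card F : ℚ) ≠ 0) (by linear_combination h2)
    rw [h3, div_mul_cancel₀ _ hpos.ne']
    linear_combination h1
  refine (pairSum_le le_rfl (by positivity) (by simp [h0]) ratio).trans ?_
  rw [h0, hn, pow_one, zero_add, Nat.cast_zero, sub_zero]
  refine mul_le_mul_of_nonneg_right ?_ (by linarith)
  rw [div_le_div_iff₀ hpos (by linarith)]
  rcases hs with rfl | rfl
  · have h4 : 4 ≤ Nat.card F := by
      rcases hq.eq_or_lt with h | h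
      · exact absurd ⟨h.symm, hsc⟩ hex
      · exact h
    have h4' : (4 : ℚ) ≤ Nat.card F := by exact_mod_cast h4
    push_cast
    linarith
  · push_cast
    linarith

/-- The bound for the expected number of common points. -/
theorem pairSum_le_bound (hq : 3 ≤ Nat.card F) (hQ : IsNondegenerate Q)
    (hU : IsNondegenerateOn Q U) (hU' : IsNondegenerateOn Q U') (hn : 1 ≤ finrank F U)
    (hn' : 1 ≤ finrank F U') (hd : finrank F V = finrank F U + finrank F U')
    (hex : ¬ (finrank F U = 1 ∧ finrank F U' = 1 ∧ Nat.card F = 3 ∧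
      HasSignedCounts Q (⊤ : Submodule F V) 1 1)) :
    pairSum Q U U' ≤ 43 / (16 * (Nat.card F : ℚ)) * (Nat.card F - 1) := by
  rw [isNondegenerate_iff] at hQ
  wlog hle : finrank F U ≤ finrank F U' generalizing U U'
  · rw [pairSum_comm]
    exact this hU' hU hn' hn (by omega) (fun h => hex ⟨h.2.1, h.1, h.2.2⟩) (by omega)
  rcases Nat.lt_or_ge (finrank F U') 3 with h3 | h3
  · have hn2 : finrank F U = 1 ∨ finrank F U = 2 := by omega
    have hn2' : finrank F U' = 1 ∨ finrank F U' = 2 := by omega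
    rcases hn2 with h | h <;> rcases hn2' with h' | h'
    · exact pairSum_le_line_line hq hQ hU hU' h h' (by omega) fun hh => hex ⟨h, h', hh⟩
    · exact pairSum_le_line_plane hq hQ hU hU' h h' (by omega)
    · omega
    · exact pairSum_le_plane_plane hq hQ hU hU' h h' (by omega)
  · exact pairSum_le_of_three_le hq hQ hU hU' hn h3 hd

end PairBounds

/-! ### Isometry invariance of types and of the families of subspaces. -/

section Isometry

variable {F : Type*} [Field F] {V V' : Type*} [AddCommGroup V] [Module F V]
  [AddCommGroup V'] [Module F V'] {Q : QuadraticForm F V} {Q' : QuadraticForm F V'}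

theorem polar_map_of_isometry {e : V ≃ₗ[F] V'} (he : ∀ x, Q' (e x) = Q x) (x y : V) :
    polar Q' (e x) (e y) = polar Q x y := by
  simp only [polar, ← map_add, he]

theorem wittIndex_congr (e : V ≃ₗ[F] V') (he : ∀ x, Q' (e x) = Q x) :
    wittIndex Q' = wittIndex Q := by
  unfold wittIndex
  congr 1
  ext k
  constructor
  · rintro ⟨W, hW, rfl⟩
    refine ⟨W.map (e.symm : V' →ₗ[F] V), ?_, LinearEquiv.finrank_map_eq e.symm W⟩
    rintro - ⟨w, hw, rfl⟩
    rw [← he]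
    simpa using hW w hw
  · rintro ⟨W, hW, rfl⟩
    refine ⟨W.map (e : V →ₗ[F] V'), ?_, LinearEquiv.finrank_map_eq e W⟩
    rintro - ⟨w, hw, rfl⟩
    simpa [he] using hW w hw

theorem hasIsometryType_congr (e : V ≃ₗ[F] V') (he : ∀ x, Q' (e x) = Q x) (ε : IsometryType) :
    HasIsometryType Q' ε ↔ HasIsometryType Q ε := by
  cases ε <;> simp only [HasIsometryType, wittIndex_congr e he, e.finrank_eq]

theorem isSquare_sq_mul_iff {a x : F} (ha : a ≠ 0) : IsSquare (a ^ 2 * x) ↔ IsSquare x := by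
  constructor
  · rintro ⟨r, hr⟩
    refine ⟨a⁻¹ * r, ?_⟩
    field_simp
    linear_combination hr
  · rintro ⟨r, rfl⟩
    exact ⟨a * r, by ring⟩

/-- A change of basis multiplies the Gram determinant by the square of a non-zero determinant. -/
theorem isSquare_gramDet_iff [Module.Finite F V] {ι : Type*} [Fintype ι] [DecidableEq ι]
    (b : Basis ι F V) : IsSquare (gramDet Q) ↔
      IsSquare (Matrix.of fun i j => polar Q (b i) (b j)).det := by
  let e : ι ≃ Fin (finrank F V) := Fintype.equivOfCardEq (by
    rw [Fintype.card_fin, finrank_eq_card_basis b])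
  let c := b.reindex e
  have h1 : (Matrix.of fun i j => polar Q (b i) (b j)).det =
      (LinearMap.BilinForm.toMatrix c (polarBilin Q)).det := by
    rw [← Matrix.det_submatrix_equiv_self e.symm]
    congr 1
    ext i j
    simp [c, LinearMap.BilinForm.toMatrix_apply]
  have h2 : gramDet Q = (LinearMap.BilinForm.toMatrix (finBasis F V) (polarBilin Q)).det := by
    rw [gramDet]
    congr 1
    ext i j
    simp [LinearMap.BilinForm.toMatrix_apply]
  have h3 := congrArg Matrix.det
    (LinearMap.BilinForm.toMatrix_mul_basis_toMatrix (finBasis F V) c (polarBilin Q))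
  rw [Matrix.det_mul, Matrix.det_mul, Matrix.det_transpose, ← h1, ← h2] at h3
  have h4 : ((finBasis F V).toMatrix c).det ≠ 0 := by
    have h5 := congrArg Matrix.det (Basis.toMatrix_mul_toMatrix_flip (finBasis F V) c)
    rw [Matrix.det_mul, Matrix.det_one] at h5
    exact left_ne_zero_of_mul_eq_one h5
  rw [← h3, ← isSquare_sq_mul_iff (x := gramDet Q) h4]
  congr! 1
  ring

theorem hasDelta_congr [Module.Finite F V] [Module.Finite F V'] (e : V ≃ₗ[F] V')
    (he : ∀ x, Q' (e x) = Q x) (σ : Sign) : HasDelta Q' σ ↔ HasDelta Q σ := by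
  have h : IsSquare (gramDet Q') ↔ IsSquare (gramDet Q) := by
    rw [isSquare_gramDet_iff ((finBasis F V).map e), gramDet]
    simp only [Basis.map_apply, polar_map_of_isometry he]
  cases σ <;> simp only [HasDelta, h]

variable {g : V ≃ₗ[F] V}

theorem restrict_submoduleMap (hg : ∀ x, Q (g x) = Q x) (U : Submodule F V) (x : U) :
    Q.restrict (U.map (g : V →ₗ[F] V)) (g.submoduleMap U x) = Q.restrict U x := by
  simp [restrict_apply, hg]

theorem perp_map (hg : ∀ x, Q (g x) = Q x) (U : Submodule F V) :
    perp Q (U.map (g : V →ₗ[F] V)) = (perp Q U).map (g : V →ₗ[F] V) := by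
  ext v
  rw [mem_perp, Submodule.mem_map_equiv, mem_perp]
  constructor
  · intro h u hu
    rw [← polar_map_of_isometry hg, LinearEquiv.apply_symm_apply]
    exact h _ (Submodule.mem_map_of_mem hu)
  · rintro h - ⟨u, hu, rfl⟩
    have := h u hu
    rwa [← polar_map_of_isometry hg, LinearEquiv.apply_symm_apply] at this

theorem isNondegenerateOn_map (hg : ∀ x, Q (g x) = Q x) {U : Submodule F V}
    (hU : IsNondegenerateOn Q U) : IsNondegenerateOn Q (U.map (g : V →ₗ[F] V)) := by
  rintro - ⟨v, hv, rfl⟩ h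
  have := hU v hv fun u hu => by
    rw [← polar_map_of_isometry hg]
    exact h _ (Submodule.mem_map_of_mem hu)
  simp [this]

theorem map_mem_nondegSubspaces [Module.Finite F V] (hg : ∀ x, Q (g x) = Q x) {n : ℕ} {σ : Sign}
    {U : Submodule F V} (hU : U ∈ nondegSubspaces Q n σ) :
    U.map (g : V →ₗ[F] V) ∈ nondegSubspaces Q n σ := by
  obtain ⟨hn, hnd, hσ⟩ := hU
  have hfin : ∀ W : Submodule F V, finrank F (W.map (g : V →ₗ[F] V)) = finrank F W :=
    fun W => LinearEquiv.finrank_map_eq g W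
  refine ⟨(hfin U).trans hn, ?_, ?_⟩
  · rw [isNondegenerate_restrict_iff] at hnd ⊢
    exact isNondegenerateOn_map hg hnd
  · unfold HasSubspaceType at hσ ⊢
    rw [perp_map hg, hfin, hfin, hasIsometryType_congr _ (restrict_submoduleMap hg U),
      hasIsometryType_congr _ (restrict_submoduleMap hg (perp Q U)),
      hasDelta_congr _ (restrict_submoduleMap hg U)]
    exact hσ

end Isometry

/-! ### Double counting of incident vectors and subspaces. -/

section DoubleCounting

variable {F : Type*} [Field F] [Fintype F] {V : Type*} [AddCommGroup V] [Module F V]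
  [Module.Finite F V] {Q : QuadraticForm F V} {U : Submodule F V}

open scoped Classical in
omit [Fintype F] [Module.Finite F V] in
theorem card_filter_mem_le {S : Finset (Submodule F V)} {g : V ≃ₗ[F] V}
    (hS : ∀ W ∈ S, W.map (g : V →ₗ[F] V) ∈ S) (v : V) :
    (S.filter fun W => v ∈ W).card ≤ (S.filter fun W => g v ∈ W).card := by
  refine Finset.card_le_card_of_injOn (fun W => W.map (g : V →ₗ[F] V)) ?_ ?_
  · intro W hW
    rw [Finset.mem_coe, Finset.mem_filter] at hW ⊢
    exact ⟨hS W hW.1, Submodule.mem_map_of_mem hW.2⟩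
  · exact (Submodule.map_injective_of_injective g.injective).injOn

open scoped Classical in
omit [Fintype F] [Module.Finite F V] in
theorem nonzeroCount_eq_card_filter [Fintype V] (t : F) :
    nonzeroCount Q U t = (Finset.univ.filter fun v => v ∈ U ∧ v ≠ 0 ∧ Q v = t).card := by
  rw [nonzeroCount, Nat.card_eq_fintype_card, Fintype.card_subtype]

open scoped Classical in
/-- In an isometry-invariant family of subspaces, each non-zero vector with a given value of `Q`
lies in equally many members. -/
theorem nonzeroCount_mul_card_filter_mem (hq : 3 ≤ Nat.card F) (hQ : IsNondegenerate Q)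
    {S : Finset (Submodule F V)}
    (hS : ∀ g : V ≃ₗ[F] V, (∀ x, Q (g x) = Q x) → ∀ W ∈ S, W.map (g : V →ₗ[F] V) ∈ S)
    {v : V} (hv : v ≠ 0) :
    nonzeroCount Q ⊤ (Q v) * (S.filter fun W => v ∈ W).card =
      ∑ W ∈ S, nonzeroCount Q W (Q v) := by
  have : Finite V := Module.finite_of_finite F
  have : Fintype V := Fintype.ofFinite V
  have hle : ∀ {x y : V}, x ≠ 0 → y ≠ 0 → Q x = Q y →
      (S.filter fun W => x ∈ W).card ≤ (S.filter fun W => y ∈ W).card := by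
    intro x y hx hy hxy
    obtain ⟨g, hg, rfl⟩ := exists_isometry_map_eq hq hQ hx hy hxy
    exact card_filter_mem_le (hS g hg) x
  rw [nonzeroCount_eq_card_filter, ← smul_eq_mul, ← Finset.sum_const]
  -- By transitivity, the number of members through a non-zero vector depends only on its value;
  -- summing it over all vectors of that value counts incidences.
  have h1 : ∀ x ∈ Finset.univ.filter (fun x => x ∈ (⊤ : Submodule F V) ∧ x ≠ 0 ∧ Q x = Q v),
      (S.filter fun W => v ∈ W).card = (S.filter fun W => x ∈ W).card := by
    intro x hx
    simp only [Finset.mem_filter] at hx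
    exact le_antisymm (hle hv hx.2.2.1 hx.2.2.2.symm) (hle hx.2.2.1 hv hx.2.2.2)
  rw [Finset.sum_congr rfl h1]
  refine (Finset.sum_card_bipartiteAbove_eq_sum_card_bipartiteBelow
    (fun (x : V) (W : Submodule F V) => x ∈ W)).trans (Finset.sum_congr rfl fun W _ => ?_)
  rw [nonzeroCount_eq_card_filter, Finset.bipartiteBelow, Finset.filter_filter]
  congr 1
  ext x
  simp [and_comm]

open scoped Classical in
omit [Fintype F] [Module.Finite F V] in
theorem natCard_sub_one_le_of_ne_bot [Finite F] [Fintype V] {W : Submodule F V} (hW : W ≠ ⊥) :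
    Nat.card F ≤ (Finset.univ.filter fun v => v ≠ 0 ∧ v ∈ W).card + 1 := by
  obtain ⟨w, hw, hw0⟩ := W.exists_mem_ne_zero_of_ne_bot hW
  rw [← natCard_ne_zero_add_one, Nat.add_le_add_iff_right]
  have : Fintype F := Fintype.ofFinite F
  rw [Nat.card_eq_fintype_card, Fintype.card_subtype]
  refine Finset.card_le_card_of_injOn (fun a : F => a • w) ?_ ?_
  · intro a ha
    rw [Finset.mem_coe, Finset.mem_filter] at ha ⊢
    exact ⟨Finset.mem_univ _, smul_ne_zero ha.2 hw0, W.smul_mem a hw⟩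
  · exact (smul_left_injective F hw0).injOn

open scoped Classical in
/-- The union bound over the points of `U`. -/
theorem mul_card_filter_inf_ne_bot_le (hq : 3 ≤ Nat.card F) (hQ : IsNondegenerate Q)
    {S : Finset (Submodule F V)}
    (hS : ∀ g : V ≃ₗ[F] V, (∀ x, Q (g x) = Q x) → ∀ W ∈ S, W.map (g : V →ₗ[F] V) ∈ S)
    (U : Submodule F V) :
    ((Nat.card F : ℚ) - 1) * (S.filter fun W => U ⊓ W ≠ ⊥).card ≤ ∑ W ∈ S, pairSum Q U W := by
  have : Finite V := Module.finite_of_finite F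
  have : Fintype V := Fintype.ofFinite V
  let X : Finset V := Finset.univ.filter fun v => v ≠ 0 ∧ v ∈ U
  -- Each `W` meeting `U` shares at least $q-1$ non-zero vectors with it.
  have h1 : ((Nat.card F : ℚ) - 1) * (S.filter fun W => U ⊓ W ≠ ⊥).card ≤
      ∑ W ∈ S, ((X.filter fun v => v ∈ W).card : ℚ) := by
    rw [mul_comm, ← nsmul_eq_mul, ← Finset.sum_const]
    refine (Finset.sum_le_sum fun W hW => ?_).trans
      (Finset.sum_le_sum_of_subset_of_nonneg (Finset.filter_subset _ _) fun _ _ _ => by positivity)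
    have h := natCard_sub_one_le_of_ne_bot (Finset.mem_filter.1 hW).2
    have heq : (Finset.univ.filter fun v => v ≠ 0 ∧ v ∈ U ⊓ W) = X.filter fun v => v ∈ W := by
      ext v
      simp [X, and_assoc]
    rw [heq] at h
    have : (Nat.card F : ℚ) ≤ (X.filter fun v => v ∈ W).card + 1 := by exact_mod_cast h
    linarith
  have h2 : ∑ W ∈ S, ((X.filter fun v => v ∈ W).card : ℚ) =
      ∑ v ∈ X, ((S.filter fun W => v ∈ W).card : ℚ) := by
    exact_mod_cast (Finset.sum_card_bipartiteAbove_eq_sum_card_bipartiteBelow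
      (s := X) (t := S) (fun (x : V) (W : Submodule F V) => x ∈ W)).symm
  refine h1.trans (le_of_eq ?_)
  rw [h2]
  have h3 : ∀ v ∈ X, ((S.filter fun W => v ∈ W).card : ℚ) =
      ∑ W ∈ S, (nonzeroCount Q W (Q v) : ℚ) / nonzeroCount Q ⊤ (Q v) := by
    intro v hv
    have hv0 : v ≠ 0 := (Finset.mem_filter.1 hv).2.1
    have hne : (nonzeroCount Q ⊤ (Q v) : ℚ) ≠ 0 := by
      rw [nonzeroCount_eq_card_filter]
      exact_mod_cast (Finset.card_pos.2 ⟨v, by simp [hv0]⟩).ne'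
    rw [← Finset.sum_div, eq_div_iff hne, mul_comm]
    exact_mod_cast nonzeroCount_mul_card_filter_mem hq hQ hS hv0
  -- The summand depends on `v` only through `Q v`; grouping by this value produces `pairSum`.
  rw [Finset.sum_congr rfl h3, ← Finset.sum_fiberwise X Q]
  simp only [pairSum]
  rw [Finset.sum_comm]
  refine Finset.sum_congr rfl fun t _ => ?_
  have h4 : ∀ v ∈ X.filter (fun v => Q v = t),
      ∑ W ∈ S, (nonzeroCount Q W (Q v) : ℚ) / nonzeroCount Q ⊤ (Q v) =
        ∑ W ∈ S, (nonzeroCount Q W t : ℚ) / nonzeroCount Q ⊤ t := by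
    intro v hv
    rw [(Finset.mem_filter.1 hv).2]
  rw [Finset.sum_congr rfl h4, Finset.sum_const, nsmul_eq_mul, Finset.mul_sum]
  have h5 : (X.filter fun v => Q v = t).card = nonzeroCount Q U t := by
    rw [nonzeroCount_eq_card_filter, Finset.filter_filter]
    congr 1
    ext v
    simp [and_comm, and_assoc]
  rw [h5]
  exact Finset.sum_congr rfl fun W _ => by rw [mul_div_assoc]

end DoubleCounting

/-! ### Orthogonal complements. -/

section Perp

variable {F : Type*} [Field F] {V : Type*} [AddCommGroup V] [Module F V] [Module.Finite F V]
  {Q : QuadraticForm F V}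

omit [Module.Finite F V] in
theorem isRefl_polarBilin (Q : QuadraticForm F V) : LinearMap.BilinForm.IsRefl (polarBilin Q) :=
  fun x y h => by
    rw [polarBilin_apply_apply] at h ⊢
    rw [polar_comm, h]

theorem finrank_perp_add (hQ : IsNondegenerate Q) (U : Submodule F V) :
    finrank F (perp Q U) + finrank F U = finrank F V := by
  have h := LinearMap.BilinForm.finrank_orthogonal (B := polarBilin Q) hQ U
  have hle := U.finrank_le
  have : finrank F (perp Q U) = finrank F V - finrank F U := h
  omega

theorem perp_perp (hQ : IsNondegenerate Q) (U : Submodule F V) : perp Q (perp Q U) = U :=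
  LinearMap.BilinForm.orthogonal_orthogonal (B := polarBilin Q) hQ (isRefl_polarBilin Q) U

theorem isNondegenerateOn_perp (hQ : IsNondegenerate Q) {U : Submodule F V}
    (hU : IsNondegenerateOn Q U) : IsNondegenerateOn Q (perp Q U) := by
  intro v hv h
  have hvU : v ∈ U := by
    rw [← perp_perp hQ U, mem_perp]
    intro u hu
    rw [polar_comm]
    exact h u hu
  refine hU v hvU fun u hu => ?_
  rw [polar_comm]
  exact mem_perp.1 hv u hu

/-- A totally singular subspace lies in its own orthogonal complement. -/
theorem two_mul_finrank_le_of_totallySingular (hQ : IsNondegenerate Q) {T : Submodule F V}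
    (hT : ∀ x ∈ T, Q x = 0) : 2 * finrank F T ≤ finrank F V := by
  have hle : T ≤ perp Q T := fun x hx => mem_perp.2 fun y hy => by
    rw [polar, hT _ (T.add_mem hy hx), hT y hy, hT x hx]
    simp
  have h1 := Submodule.finrank_mono hle
  have h2 := finrank_perp_add hQ T
  omega

end Perp

/-! ### The Witt index and the sign of the value counts. -/

section WittIndex

variable {F : Type*} [Field F] {V : Type*} [AddCommGroup V] [Module F V] [Module.Finite F V]
  {Q : QuadraticForm F V}

theorem bddAbove_finrank_totallySingular (Q : QuadraticForm F V) :
    BddAbove {k : ℕ | ∃ W : Submodule F V, (∀ w ∈ W, Q w = 0) ∧ finrank F W = k} := by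
  refine ⟨finrank F V, ?_⟩
  rintro k ⟨W, -, rfl⟩
  exact W.finrank_le

theorem finrank_le_wittIndex {T : Submodule F V} (hT : ∀ x ∈ T, Q x = 0) :
    finrank F T ≤ wittIndex Q :=
  le_csSup (bddAbove_finrank_totallySingular Q) ⟨T, hT, rfl⟩

theorem exists_finrank_eq_wittIndex (Q : QuadraticForm F V) :
    ∃ T : Submodule F V, (∀ x ∈ T, Q x = 0) ∧ finrank F T = wittIndex Q :=
  Nat.sSup_mem
    (s := {k : ℕ | ∃ W : Submodule F V, (∀ w ∈ W, Q w = 0) ∧ finrank F W = k}) ⟨0, ⊥, fun w hw => by rw [(Submodule.mem_bot F).1 hw, QuadraticMap.map_zero],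
    finrank_bot F V⟩ (bddAbove_finrank_totallySingular Q)

theorem two_mul_wittIndex_le (hQ : IsNondegenerate Q) : 2 * wittIndex Q ≤ finrank F V := by
  obtain ⟨T, hT, hd⟩ := exists_finrank_eq_wittIndex Q
  rw [← hd]
  exact two_mul_finrank_le_of_totallySingular hQ hT

theorem finrank_le_wittIndex_restrict {U T : Submodule F V} (hTU : T ≤ U)
    (hT : ∀ x ∈ T, Q x = 0) : finrank F T ≤ wittIndex (Q.restrict U) := by
  rw [← LinearEquiv.finrank_eq (Submodule.comapSubtypeEquivOfLe hTU)]
  refine finrank_le_wittIndex ?_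
  intro x hx
  rw [restrict_apply]
  exact hT x hx

theorem exists_finrank_eq_wittIndex_restrict (Q : QuadraticForm F V) (U : Submodule F V) :
    ∃ T ≤ U, (∀ x ∈ T, Q x = 0) ∧ finrank F T = wittIndex (Q.restrict U) := by
  obtain ⟨T, hT, hd⟩ := exists_finrank_eq_wittIndex (Q.restrict U)
  refine ⟨T.map U.subtype, Submodule.map_subtype_le U T, ?_, ?_⟩
  · rintro - ⟨x, hx, rfl⟩
    exact hT x hx
  · rw [← hd]
    exact LinearEquiv.finrank_eq (Submodule.equivMapOfInjective _ U.subtype_injective _).symm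

theorem hasIsometryType_hyperbolic_of_totallySingular {U T : Submodule F V}
    (hU : IsNondegenerateOn Q U) (hTU : T ≤ U) (hT : ∀ x ∈ T, Q x = 0)
    (hd : finrank F U = 2 * finrank F T) : HasIsometryType (Q.restrict U) .hyperbolic := by
  have h1 := finrank_le_wittIndex_restrict hTU hT
  have h2 := two_mul_wittIndex_le ((isNondegenerate_restrict_iff Q U).2 hU)
  change finrank F U = 2 * wittIndex (Q.restrict U)
  omega

variable [Finite F]

/-- A totally singular subspace of half the dimension would force sign $+1$, and the number of
singular vectors distinguishes the signs. -/
theorem hasIsometryType_elliptic_of_hasSignedCounts {U T : Submodule F V}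
    (hU : IsNondegenerateOn Q U) (hTU : T ≤ U) (hT : ∀ x ∈ T, Q x = 0)
    (hd : finrank F U = 2 * (finrank F T + 1)) (hs : HasSignedCounts Q U (finrank F T + 1) (-1)) :
    HasIsometryType (Q.restrict U) .elliptic := by
  have h1 := finrank_le_wittIndex_restrict hTU hT
  have h2 : wittIndex (Q.restrict U) < finrank F T + 1 := by
    by_contra! hle
    obtain ⟨T', hTU', hT', hd'⟩ := exists_finrank_eq_wittIndex_restrict Q U
    have hs' := hasSignedCounts_of_totallySingular _ hU hd hTU' hT' (hd'.symm ▸ hle)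
    have h3 := (hs 0).symm.trans (hs' 0)
    rw [if_pos rfl, pow_succ _ (finrank F T + 1)] at h3
    have hq : 1 < (Nat.card F : ℤ) := by exact_mod_cast one_lt_natCard
    have hx : 0 < (Nat.card F : ℤ) ^ (finrank F T + 1) := by positivity
    nlinarith
  change finrank F U = 2 * wittIndex (Q.restrict U) + 2
  omega

end WittIndex

/-! ### Existence of even-dimensional subspaces of both types. -/

section EvenSubspaces

variable {F : Type*} [Field F] [Finite F] {V : Type*} [AddCommGroup V] [Module F V]
  [Module.Finite F V] {Q : QuadraticForm F V}

theorem exists_singular_of_three_le {W : Submodule F V} (hW : IsNondegenerateOn Q W)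
    (hd : 3 ≤ finrank F W) : ∃ e ∈ W, e ≠ 0 ∧ Q e = 0 := by
  by_contra! h
  have := finrank_le_two_of_anisotropic hW fun x hx hx0 => by
    by_contra hne
    exact h x hx hne hx0
  omega

/-- For each `c` there is a quadratic polynomial with constant term `c` and without roots. -/
theorem exists_quadratic_ne_zero {c : F} (hc : c ≠ 0) : ∃ b : F, ∀ x : F, x * x - b * x + c ≠ 0 := by
  by_contra! h
  -- A root of $x^2-bx+c$ solves $x+c/x=b$. Roots for every $b$ would map $q-1$ elements onto $q$.
  have hsurj : Function.Surjective fun x : {x : F // x ≠ 0} => x.1 + c / x.1 := by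
    intro b
    obtain ⟨x, hx⟩ := h b
    have hx0 : x ≠ 0 := by
      rintro rfl
      simp [hc] at hx
    refine ⟨⟨x, hx0⟩, ?_⟩
    simp only
    field_simp
    linear_combination hx
  have h1 := Nat.card_le_card_of_surjective _ hsurj
  have h2 := natCard_ne_zero_add_one (F := F)
  omega

/-- If the expression vanished, $b/2$ would be a root when $2\ne0$; in characteristic 2, $b=0$ and a
square root of $c$ is one. -/
theorem four_mul_sub_sq_ne_zero {b c : F} (h : ∀ x : F, x * x - b * x + c ≠ 0) :
    4 * c - b * b ≠ 0 := by
  intro h0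
  by_cases h2 : (2 : F) = 0
  · have hb : b = 0 := by
      have : b * b = 0 := by linear_combination 2 * c * h2 - h0
      simpa using this
    have hchar : ringChar F = 2 := by
      by_contra hne
      exact Ring.two_ne_zero hne h2
    obtain ⟨r, hr⟩ := FiniteField.isSquare_of_char_two hchar c
    refine h r ?_
    rw [hb, hr]
    linear_combination r * r * h2
  · refine h (b / 2) ?_
    field_simp
    linear_combination h0

/-- A non-degenerate space of dimension at least three contains an anisotropic plane. -/
theorem exists_anisotropic_plane {W : Submodule F V} (hW : IsNondegenerateOn Q W)
    (hd : 3 ≤ finrank F W) : ∃ A ≤ W, IsNondegenerateOn Q A ∧ (∀ x ∈ A, Q x = 0 → x = 0) ∧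
      finrank F A = 2 := by
  obtain ⟨e, heW, he0, he⟩ := exists_singular_of_three_le hW hd
  obtain ⟨f, hfW, W', hW'W, h, hWe, hWf, hW', rfl⟩ := hW.exists_hyperbolicSum heW he0 he
  rw [h.finrank_hyperbolicSum hWe hWf] at hd
  obtain ⟨w, hw, hQw⟩ : ∃ w ∈ W', Q w ≠ 0 := by
    by_contra! hall
    obtain ⟨w, hw, hw0⟩ := W'.exists_mem_ne_zero_of_ne_bot (by
      rintro rfl
      simp at hd)
    refine hw0 (hW' w hw fun u hu => ?_)
    rw [polar, hall _ (W'.add_mem hw hu), hall w hw, hall u hu]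
    simp
  obtain ⟨b, hb⟩ := exists_quadratic_ne_zero hQw
  -- On the span of $e+f$ and $bf+w$ the form is $x^2+bxy+Q(w)y^2$, anisotropic by the choice of
  -- $b$. Its polar form has determinant $4Q(w)-b^2\ne0$.
  let u := e + f
  let v := b • f + w
  have hform : ∀ x y : F, x • u + y • v = x • e + ((x + y * b) • f + y • w) := by
    intro x y
    simp only [u, v]
    module
  have hval : ∀ x y : F, Q (x • u + y • v) = x * x + b * x * y + y * y * Q w := by
    intro x y
    rw [hform, h.map_combination _ _ (by rw [polar_smul_right, hWe w hw, smul_zero])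
      (by rw [polar_smul_right, hWf w hw, smul_zero]), map_smul_eq]
    ring
  have haniso : ∀ x y : F, Q (x • u + y • v) = 0 → x = 0 ∧ y = 0 := by
    intro x y hxy
    rw [hval] at hxy
    have hy : y = 0 := by
      by_contra hy
      apply hb (-(x / y))
      field_simp
      linear_combination hxy
    subst hy
    exact ⟨by simpa using hxy, rfl⟩
  have hpol : ∀ x y x' y' : F, polar Q (x • u + y • v) (x' • u + y' • v) =
      2 * x * x' + b * (x * y' + y * x') + 2 * Q w * y * y' := by
    intro x y x' y'
    have hadd : x • u + y • v + (x' • u + y' • v) = (x + x') • u + (y + y') • v := by module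
    rw [polar, hadd, hval, hval, hval]
    ring
  let φ : (F × F) →ₗ[F] V :=
    (LinearMap.toSpanSingleton F V u).coprod (LinearMap.toSpanSingleton F V v)
  have hφ : ∀ x y, φ (x, y) = x • u + y • v := fun x y => rfl
  have hinj : Function.Injective φ := by
    rw [injective_iff_map_eq_zero]
    rintro ⟨x, y⟩ hxy
    rw [hφ] at hxy
    obtain ⟨rfl, rfl⟩ := haniso x y (by rw [hxy, QuadraticMap.map_zero])
    rfl
  refine ⟨LinearMap.range φ, ?_, ?_, ?_, ?_⟩
  · rintro - ⟨⟨x, y⟩, rfl⟩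
    rw [hφ, hform]
    exact mem_hyperbolicSum.2 ⟨_, _, _, W'.smul_mem y hw, rfl⟩
  · rintro - ⟨⟨x, y⟩, rfl⟩ hall
    have h1 := hall _ ⟨(1, 0), rfl⟩
    have h2 := hall _ ⟨(0, 1), rfl⟩
    rw [hφ, hφ, hpol] at h1 h2
    have hdisc := four_mul_sub_sq_ne_zero hb
    have hx : x = 0 := (mul_eq_zero.1 (by linear_combination 2 * Q w * h1 - b * h2 :
      (4 * Q w - b * b) * x = 0)).resolve_left hdisc
    have hy : y = 0 := (mul_eq_zero.1 (by linear_combination 2 * h2 - b * h1 :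
      (4 * Q w - b * b) * y = 0)).resolve_left hdisc
    rw [hx, hy, hφ, zero_smul, zero_smul, add_zero]
  · rintro - ⟨⟨x, y⟩, rfl⟩ hxy
    obtain ⟨rfl, rfl⟩ := haniso x y hxy
    rw [hφ, zero_smul, zero_smul, add_zero]
  · rw [LinearMap.finrank_range_of_inj hinj]
    simp

/-- `U` has dimension `2 k`, is counted with sign `s`, and contains a totally singular subspace of
dimension `j`. -/
structure IsEvenSubspace (Q : QuadraticForm F V) (U : Submodule F V) (k : ℕ) (s : ℤ) (j : ℕ) :
    Prop where
  nondegenerate : IsNondegenerateOn Q U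
  finrank_eq : finrank F U = 2 * k
  signedCounts : HasSignedCounts Q U k s
  exists_totallySingular : ∃ T ≤ U, (∀ x ∈ T, Q x = 0) ∧ finrank F T = j

theorem IsHyperbolicPair.isEvenSubspace_hyperbolicSum {e f : V} {U : Submodule F V}
    (h : IsHyperbolicPair Q e f) (he : ∀ w ∈ U, polar Q e w = 0) (hf : ∀ w ∈ U, polar Q f w = 0)
    {k j : ℕ} {s : ℤ} (hU : IsEvenSubspace Q U k s j) :
    IsEvenSubspace Q (hyperbolicSum e f U) (k + 1) s (j + 1) := by
  refine ⟨h.isNondegenerateOn_hyperbolicSum he hf hU.nondegenerate, ?_,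
    h.hasSignedCounts he hf hU.finrank_eq hU.signedCounts, ?_⟩
  · rw [h.finrank_hyperbolicSum he hf, hU.finrank_eq]
    ring
  · obtain ⟨T, hTU, hT, hd⟩ := hU.exists_totallySingular
    refine ⟨T ⊔ Submodule.span F {e}, ?_, ?_, ?_⟩
    · refine sup_le (fun x hx => mem_hyperbolicSum.2 ⟨0, 0, x, hTU hx, by simp⟩) ?_
      rw [Submodule.span_singleton_le_iff_mem]
      exact mem_hyperbolicSum.2 ⟨1, 0, 0, U.zero_mem, by simp⟩
    · intro x hx
      obtain ⟨y, hy, z, hz, rfl⟩ := Submodule.mem_sup.1 hx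
      obtain ⟨a, rfl⟩ := Submodule.mem_span_singleton.1 hz
      rw [map_add_eq, map_smul_eq, hT y hy, h.left, polar_smul_right, polar_comm,
        he y (hTU hy)]
      simp
    · rw [Submodule.finrank_sup_span_singleton, hd]
      intro heT
      have := hf e (hTU heT)
      rw [h.polar_eq_one'] at this
      exact one_ne_zero this

/-- Each step takes a hyperbolic plane out of `W` and recurses in its complement. The spare
dimension `+ 1` keeps `W` of dimension at least 3, so that a singular vector exists. The base is the
zero space for $s=1$ and an anisotropic plane for $s=-1$. -/
theorem exists_isEvenSubspace_add (k₀ j₀ : ℕ) (s : ℤ)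
    (hbase : ∀ W : Submodule F V, IsNondegenerateOn Q W → 2 * k₀ + 1 ≤ finrank F W →
      ∃ U ≤ W, IsEvenSubspace Q U k₀ s j₀) (i : ℕ) :
    ∀ W : Submodule F V, IsNondegenerateOn Q W → 2 * (k₀ + i) + 1 ≤ finrank F W →
      ∃ U ≤ W, IsEvenSubspace Q U (k₀ + i) s (j₀ + i) := by
  induction i with
  | zero => exact hbase
  | succ i ih =>
    intro W hW hd
    obtain ⟨e, heW, he0, he⟩ := exists_singular_of_three_le hW (by omega)
    obtain ⟨f, hfW, W', hW'W, h, hWe, hWf, hW', rfl⟩ := hW.exists_hyperbolicSum heW he0 he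
    rw [h.finrank_hyperbolicSum hWe hWf] at hd
    obtain ⟨U, hUW, hU⟩ := ih W' hW' (by omega)
    refine ⟨hyperbolicSum e f U, ?_, h.isEvenSubspace_hyperbolicSum (fun w hw => hWe w (hUW hw))
      (fun w hw => hWf w (hUW hw)) hU⟩
    intro x hx
    obtain ⟨a, b, w, hw, rfl⟩ := mem_hyperbolicSum.1 hx
    exact mem_hyperbolicSum.2 ⟨a, b, w, hUW hw, rfl⟩

theorem exists_isEvenSubspace_plus (k : ℕ) {W : Submodule F V} (hW : IsNondegenerateOn Q W)
    (hd : 2 * k + 1 ≤ finrank F W) : ∃ U ≤ W, IsEvenSubspace Q U k 1 k := by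
  have := exists_isEvenSubspace_add (Q := Q) 0 0 1 (fun W _ _ => ⟨⊥, bot_le,
    fun v hv _ => (Submodule.mem_bot F).1 hv, by simp, hasSignedCounts_bot Q, ⊥, le_rfl,
    fun x hx => by rw [(Submodule.mem_bot F).1 hx, QuadraticMap.map_zero], by simp⟩) k W hW
    (by omega)
  simpa using this

theorem exists_isEvenSubspace_minus (k : ℕ) {W : Submodule F V} (hW : IsNondegenerateOn Q W)
    (hd : 2 * (k + 1) + 1 ≤ finrank F W) : ∃ U ≤ W, IsEvenSubspace Q U (k + 1) (-1) k := by
  have := exists_isEvenSubspace_add (Q := Q) 1 0 (-1) (fun W hW hd => by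
    obtain ⟨A, hAW, hA, han, hdA⟩ := exists_anisotropic_plane hW (by omega)
    exact ⟨A, hAW, hA, by omega, hasSignedCounts_of_anisotropic_plane hA han hdA, ⊥, bot_le,
      fun x hx => by rw [(Submodule.mem_bot F).1 hx, QuadraticMap.map_zero], by simp⟩) k W hW
    (by omega)
  simpa [add_comm] using this

/-- Both types of even-dimensional subspaces exist. -/
theorem exists_even_hasIsometryType (hQ : IsNondegenerate Q) {n : ℕ} (hn : Even n) (hn1 : 1 ≤ n)
    (hd : n + 1 ≤ finrank F V) (σ : Sign) : ∃ U : Submodule F V, finrank F U = n ∧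
      IsNondegenerateOn Q U ∧ HasIsometryType (Q.restrict U) σ.toIsometryType := by
  rw [isNondegenerate_iff] at hQ
  obtain ⟨k, hk⟩ := hn.two_dvd
  cases σ with
  | plus =>
    obtain ⟨U, -, hU⟩ := exists_isEvenSubspace_plus k hQ (by rw [finrank_top]; omega)
    obtain ⟨T, hTU, hT, hTd⟩ := hU.exists_totallySingular
    exact ⟨U, hU.finrank_eq.trans hk.symm, hU.nondegenerate,
      hasIsometryType_hyperbolic_of_totallySingular hU.nondegenerate hTU hT
        (by rw [hU.finrank_eq, hTd])⟩
  | minus =>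
    obtain ⟨j, rfl⟩ := Nat.exists_eq_add_of_le' (by omega : 1 ≤ k)
    obtain ⟨U, -, hU⟩ := exists_isEvenSubspace_minus j hQ (by rw [finrank_top]; omega)
    obtain ⟨T, hTU, hT, hTd⟩ := hU.exists_totallySingular
    exact ⟨U, hU.finrank_eq.trans hk.symm, hU.nondegenerate,
      hasIsometryType_elliptic_of_hasSignedCounts hU.nondegenerate hTU hT
        (by rw [hU.finrank_eq, hTd]) (by rw [hTd]; exact hU.signedCounts)⟩

end EvenSubspaces

/-! ### Existence in odd dimension, and non-emptiness in general. -/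

section OddSubspaces

variable {F : Type*} [Field F] [Finite F] {V : Type*} [AddCommGroup V] [Module F V]
  [Module.Finite F V] {Q : QuadraticForm F V}

omit [Module.Finite F V] [Finite F] in
theorem polar_restrict (Q : QuadraticForm F V) (U : Submodule F V) (x y : U) :
    polar (Q.restrict U) x y = polar Q x y := by
  simp [polar, restrict_apply]

theorem ringChar_ne_two_of_odd (h : Odd (Nat.card F)) : ringChar F ≠ 2 := by
  have : Fintype F := Fintype.ofFinite F
  intro hc
  have := FiniteField.even_card_of_char_two hc
  rw [← Nat.card_eq_fintype_card] at this
  rw [Nat.odd_iff] at h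
  omega

theorem exists_map_eq_of_even {W : Submodule F V} (hW : IsNondegenerateOn Q W) {m : ℕ}
    (hm : 1 ≤ m) (hd : finrank F W = 2 * m) {t : F} (ht : t ≠ 0) : ∃ v ∈ W, Q v = t := by
  rw [← valueCount_pos_iff, ← nonzeroCount_of_ne_zero ht]
  refine Nat.pos_of_ne_zero fun h0 => ?_
  have h := (nonzeroCount_even_bounds hW hd ht).1
  rw [h0, Nat.cast_zero, mul_zero, two_mul, pow_add] at h
  have hq : 1 < (Nat.card F : ℤ) := by exact_mod_cast one_lt_natCard
  have hx : 1 < (Nat.card F : ℤ) ^ m := one_lt_pow₀ hq (by omega)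
  nlinarith

omit [Finite F] in
/-- Adjoining an orthogonal vector `v` multiplies the discriminant by `2 Q(v)`. -/
theorem exists_orthogonal_extension {U : Submodule F V} (hU : IsNondegenerateOn Q U) {v : V}
    (hv : v ∈ perp Q U) (hv2 : 2 * Q v ≠ 0) : ∃ U' : Submodule F V,
      finrank F U' = finrank F U + 1 ∧ IsNondegenerateOn Q U' ∧
      (IsSquare (gramDet (Q.restrict U')) ↔ IsSquare (gramDet (Q.restrict U) * (2 * Q v))) := by
  rw [mem_perp] at hv
  let φ : (U × F) →ₗ[F] V := U.subtype.coprod (LinearMap.toSpanSingleton F V v)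
  have hφ : ∀ u a, φ (u, a) = (u : V) + a • v := fun u a => rfl
  have hpol : ∀ (u u' : U) (a a' : F), polar Q (φ (u, a)) (φ (u', a')) =
      polar Q u u' + a * a' * (2 * Q v) := by
    intro u u' a a'
    rw [hφ, hφ, polar_add_left, polar_add_right, polar_add_right, polar_smul_left, polar_smul_left,
      polar_smul_right, polar_smul_right, hv u u.2, polar_comm (⇑Q) v, hv u' u'.2, polar_self_eq]
    simp only [smul_eq_mul]
    ring
  have hzero : ∀ (u : U) (a : F), (∀ u' a', polar Q (φ (u, a)) (φ (u', a')) = 0) →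
      u = 0 ∧ a = 0 := by
    intro u a h
    constructor
    · refine Subtype.ext (hU u u.2 fun u' hu' => ?_)
      have := h ⟨u', hu'⟩ 0
      rw [hpol] at this
      simpa using this
    · have := h 0 1
      rw [hpol] at this
      simpa [hv2] using this
  have hinj : Function.Injective φ := by
    rw [injective_iff_map_eq_zero]
    rintro ⟨u, a⟩ h0
    obtain ⟨rfl, rfl⟩ := hzero u a fun u' a' => by rw [h0, polar_zero_left]
    rfl
  refine ⟨LinearMap.range φ, ?_, ?_, ?_⟩
  · rw [LinearMap.finrank_range_of_inj hinj]
    simp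
  · rintro - ⟨⟨u, a⟩, rfl⟩ h
    obtain ⟨rfl, rfl⟩ := hzero u a fun u' a' => h _ ⟨(u', a'), rfl⟩
    exact map_zero φ
  · let b : Basis (Fin (finrank F U) ⊕ Unit) F (LinearMap.range φ) :=
      ((finBasis F U).prod (Basis.singleton Unit F)).map (LinearEquiv.ofInjective φ hinj)
    rw [isSquare_gramDet_iff b]
    have hmat : (Matrix.of fun i j => polar (Q.restrict (LinearMap.range φ)) (b i) (b j)) =
        Matrix.fromBlocks (Matrix.of fun i j =>
          polar (Q.restrict U) (finBasis F U i) (finBasis F U j)) 0 0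
          (Matrix.of fun _ _ => 2 * Q v) := by
      ext (i | i) (j | j) <;>
        simp only [Matrix.of_apply, polar_restrict, b, Basis.map_apply,
          LinearEquiv.ofInjective_apply, Basis.prod_apply, Sum.elim_inl, Sum.elim_inr,
          Function.comp_apply, LinearMap.inl_apply, LinearMap.inr_apply, hpol,
          Matrix.fromBlocks_apply₁₁, Matrix.fromBlocks_apply₁₂, Matrix.fromBlocks_apply₂₁,
          Matrix.fromBlocks_apply₂₂] <;> simp
    rw [hmat, Matrix.det_fromBlocks_zero₂₁, Matrix.det_unique (Matrix.of fun _ _ : Unit => 2 * Q v),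
      gramDet]
    rfl

omit [Finite F] in
theorem gramDet_ne_zero (hQ : IsNondegenerate Q) : gramDet Q ≠ 0 := by
  have h := (LinearMap.BilinForm.nondegenerate_iff_det_ne_zero (finBasis F V)).1 hQ
  have h2 : gramDet Q = (LinearMap.BilinForm.toMatrix (finBasis F V) (polarBilin Q)).det := by
    rw [gramDet]
    congr 1
    ext i j
    simp [LinearMap.BilinForm.toMatrix_apply]
  rwa [h2]

/-- Both discriminants occur among the subspaces of odd dimension and odd codimension. -/
theorem exists_odd_hasDelta (hQ : IsNondegenerate Q) (hodd : Odd (Nat.card F)) {n n' : ℕ}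
    (hn : Odd n) (hn' : Odd n') (hd : finrank F V = n + n') (σ : Sign) :
    ∃ U : Submodule F V, finrank F U = n' ∧ IsNondegenerateOn Q U ∧ HasDelta (Q.restrict U) σ := by
  have h2 : (2 : F) ≠ 0 := Ring.two_ne_zero (ringChar_ne_two_of_odd hodd)
  obtain ⟨i, rfl⟩ := hn
  obtain ⟨k, rfl⟩ := hn'
  -- `U₀` has dimension $n'-1$, so its complement has even dimension $n+1\ge2$ and represents every
  -- non-zero $t$. Adjoining a vector of value $t$ multiplies the discriminant by $2t$.
  obtain ⟨U₀, -, hU₀⟩ := exists_isEvenSubspace_plus k ((isNondegenerate_iff Q).1 hQ)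
    (by rw [finrank_top]; omega)
  have hperp := finrank_perp_add hQ U₀
  rw [hU₀.finrank_eq] at hperp
  have hdet := gramDet_ne_zero ((isNondegenerate_restrict_iff Q U₀).2 hU₀.nondegenerate)
  have hrep : ∀ t : F, t ≠ 0 → ∃ U' : Submodule F V, finrank F U' = 2 * k + 1 ∧
      IsNondegenerateOn Q U' ∧ (IsSquare (gramDet (Q.restrict U')) ↔
        IsSquare (gramDet (Q.restrict U₀) * (2 * t))) := by
    intro t ht
    obtain ⟨v, hv, rfl⟩ := exists_map_eq_of_even (isNondegenerateOn_perp hQ hU₀.nondegenerate)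
      (m := i + 1) (by omega) (by omega) ht
    obtain ⟨U', h1, h3, h4⟩ := exists_orthogonal_extension hU₀.nondegenerate hv (mul_ne_zero h2 ht)
    exact ⟨U', by rw [h1, hU₀.finrank_eq], h3, h4⟩
  cases σ with
  | plus =>
    obtain ⟨U', h1, h3, h4⟩ := hrep (gramDet (Q.restrict U₀) / 2) (div_ne_zero hdet h2)
    refine ⟨U', h1, h3, h4.2 ?_⟩
    rw [mul_div_cancel₀ _ h2]
    exact ⟨_, rfl⟩
  | minus =>
    obtain ⟨a, ha⟩ := FiniteField.exists_nonsquare (ringChar_ne_two_of_odd hodd)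
    have ha0 : a ≠ 0 := by
      rintro rfl
      exact ha (IsSquare.zero)
    -- This value turns the discriminant $\delta$ of `U₀` into $\delta^2a$, a non-square.
    obtain ⟨U', h1, h3, h4⟩ := hrep (gramDet (Q.restrict U₀) * a / 2)
      (div_ne_zero (mul_ne_zero hdet ha0) h2)
    refine ⟨U', h1, h3, fun hsq => ha ?_⟩
    rw [h4, mul_div_cancel₀ _ h2, ← mul_assoc, ← _root_.sq, isSquare_sq_mul_iff hdet] at hsq
    exact hsq

/-- Every subspace type is realized. -/
theorem nondegSubspaces_nonempty (hQ : IsNondegenerate Q) {n n' : ℕ} (hn : 1 ≤ n) (hn' : 1 ≤ n')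
    (hodd : Odd n ∨ Odd n' → Odd (Nat.card F)) (hd : finrank F V = n + n') (σ : Sign) :
    (nondegSubspaces Q n' σ).Nonempty := by
  rcases Nat.even_or_odd n' with he' | ho'
  · obtain ⟨U, h1, h2, h3⟩ := exists_even_hasIsometryType hQ he' hn' (by omega) σ
    refine ⟨U, h1, (isNondegenerate_restrict_iff Q U).2 h2, ?_⟩
    rw [HasSubspaceType, if_pos (h1 ▸ he')]
    exact h3
  · have hne : ¬ Even n' := Nat.not_even_iff_odd.2 ho'
    rcases Nat.even_or_odd n with he | ho
    -- For $n'$ odd and $n$ even the type is read off the complement, so the complement of an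
    -- $n$-dimensional subspace of that type is taken.
    · obtain ⟨U, h1, h2, h3⟩ := exists_even_hasIsometryType hQ he hn (by omega) σ
      have hp := finrank_perp_add hQ U
      have hdim : finrank F (perp Q U) = n' := by omega
      refine ⟨perp Q U, hdim, (isNondegenerate_restrict_iff Q _).2 (isNondegenerateOn_perp hQ h2),
        ?_⟩
      rw [HasSubspaceType, hdim, if_neg hne, perp_perp hQ, if_pos (h1 ▸ he)]
      exact h3
    · obtain ⟨U, h1, h2, h3⟩ := exists_odd_hasDelta hQ (hodd (Or.inl ho)) ho ho' hd σ
      have hp := finrank_perp_add hQ U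
      have hdim : finrank F (perp Q U) = n := by omega
      refine ⟨U, h1, (isNondegenerate_restrict_iff Q U).2 h2, ?_⟩
      rw [HasSubspaceType, h1, hdim, if_neg hne, if_neg (Nat.not_even_iff_odd.2 ho)]
      exact h3

end OddSubspaces

/-! ### Lines in a plane, and the exceptional case. -/

section Lines

variable {F : Type*} [Field F] {V : Type*} [AddCommGroup V] [Module F V] [Module.Finite F V]
  {Q : QuadraticForm F V}

theorem isSquare_gramDet_line {U : Submodule F V} (hd : finrank F U = 1) {u : V} (hu : u ∈ U)
    (hu0 : u ≠ 0) : IsSquare (gramDet (Q.restrict U)) ↔ IsSquare (2 * Q u) := by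
  have hne : (⟨u, hu⟩ : U) ≠ 0 := fun h => hu0 (congrArg Subtype.val h)
  rw [isSquare_gramDet_iff (FiniteDimensional.basisSingleton Unit hd ⟨u, hu⟩ hne), Matrix.det_unique]
  simp only [Matrix.of_apply, FiniteDimensional.basisSingleton_apply, polar_self_eq, restrict_apply]

theorem hasDelta_iff_of_finrank_eq_one {σ : Sign} {U : Submodule F V} (hQ : IsNondegenerate Q)
    (hV : finrank F V = 2) (hd : finrank F U = 1) :
    HasSubspaceType Q U σ ↔ HasDelta (Q.restrict U) σ := by
  have hp := finrank_perp_add hQ U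
  have hdim : finrank F (perp Q U) = 1 := by omega
  rw [HasSubspaceType, hd, hdim, if_neg Nat.not_even_one, if_neg Nat.not_even_one]

theorem HasDelta.unique {σ σ' : Sign} (h : HasDelta Q σ) (h' : HasDelta Q σ') : σ = σ' := by
  cases σ <;> cases σ' <;> simp_all [HasDelta]

omit [Module.Finite F V] in
theorem IsNondegenerateOn.map_ne_zero_of_finrank_eq_one {U : Submodule F V}
    (hU : IsNondegenerateOn Q U) (hd : finrank F U = 1) {u : V} (hu : u ∈ U) (hu0 : u ≠ 0) :
    Q u ≠ 0 := by
  intro h0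
  refine hu0 (hU u hu fun w hw => ?_)
  obtain ⟨c, hc⟩ := (finrank_eq_one_iff_of_nonzero' (⟨u, hu⟩ : U)
    (fun h => hu0 (congrArg Subtype.val h))).1 hd ⟨w, hw⟩
  obtain rfl : c • u = w := congrArg Subtype.val hc
  rw [polar_smul_right, polar_self_eq, h0, mul_zero, smul_zero]

/-- Over $\mathbb F_3$ each square class of non-zero elements has a single element. -/
theorem eq_of_isSquare_iff [Finite F] (h3 : Nat.card F = 3) {a b : F} (ha : a ≠ 0) (hb : b ≠ 0)
    (h : IsSquare a ↔ IsSquare b) : a = b := by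
  classical
  have : Fintype F := Fintype.ofFinite F
  have hsq : ∀ x : F, x ≠ 0 → IsSquare x → x = 1 := by
    rintro x hx ⟨r, rfl⟩
    have := FiniteField.pow_card_sub_one_eq_one r (left_ne_zero_of_mul hx)
    rw [← Nat.card_eq_fintype_card, h3] at this
    linear_combination this
  by_cases hsa : IsSquare a
  · rw [hsq a ha hsa, hsq b hb (h.1 hsa)]
  · have hsb : ¬ IsSquare b := fun hs => hsa (h.2 hs)
    by_contra hab
    have hcard : ({0, 1, a, b} : Finset F).card = 4 := by
      have ha1 : (1 : F) ≠ a := fun h1 => hsa (h1 ▸ IsSquare.one)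
      have hb1 : (1 : F) ≠ b := fun h1 => hsb (h1 ▸ IsSquare.one)
      rw [Finset.card_insert_of_notMem (by simp [ha.symm, hb.symm]),
        Finset.card_insert_of_notMem (by simp [ha1, hb1]), Finset.card_pair hab]
    have := Finset.card_le_univ ({0, 1, a, b} : Finset F)
    rw [hcard, ← Nat.card_eq_fintype_card, h3] at this
    omega

variable [Finite F]

theorem hasSignedCounts_of_hyperbolic {m : ℕ} (hQ : IsNondegenerate Q) (hV : finrank F V = 2 * m)
    (hε : HasIsometryType Q .hyperbolic) : HasSignedCounts Q (⊤ : Submodule F V) m 1 := by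
  obtain ⟨T, hT, hd⟩ := exists_finrank_eq_wittIndex Q
  have hε' : finrank F V = 2 * wittIndex Q := hε
  exact hasSignedCounts_of_totallySingular m ((isNondegenerate_iff Q).1 hQ)
    (by rw [finrank_top, hV]) le_top hT (by omega)

theorem eq_hyperbolic_of_hasSignedCounts (hV : finrank F V = 2)
    (hs : HasSignedCounts Q (⊤ : Submodule F V) 1 1) {ε : IsometryType}
    (hε : HasIsometryType Q ε) : ε = .hyperbolic := by
  have hw : 1 ≤ wittIndex Q := by
    by_contra! hw
    have han : ∀ x ∈ (⊤ : Submodule F V), Q x = 0 → x = 0 := by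
      intro x _ hx
      by_contra hx0
      have := finrank_le_wittIndex (Q := Q) (T := Submodule.span F {x}) (by
        intro y hy
        obtain ⟨a, rfl⟩ := Submodule.mem_span_singleton.1 hy
        rw [map_smul_eq, hx, mul_zero])
      rw [finrank_span_singleton hx0] at this
      omega
    have h := hs 0
    rw [valueCount_zero_of_anisotropic han, if_pos rfl] at h
    have hq : 1 < (Nat.card F : ℤ) := by exact_mod_cast one_lt_natCard
    push_cast at h
    nlinarith
  cases ε with
  | hyperbolic => rfl
  | elliptic =>
    have : finrank F V = 2 * wittIndex Q + 2 := hε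
    omega
  | parabolic =>
    have : finrank F V = 2 * wittIndex Q + 1 := hε
    omega

/-- In a hyperbolic plane over the field of three elements, non-degenerate lines of the same
discriminant coincide. -/
theorem inf_ne_bot_of_hyperbolic_plane (h3 : Nat.card F = 3)
    (hs : HasSignedCounts Q (⊤ : Submodule F V) 1 1) {U U' : Submodule F V}
    (hU : IsNondegenerateOn Q U) (hU' : IsNondegenerateOn Q U') (hd : finrank F U = 1)
    (hd' : finrank F U' = 1)
    (hsq : IsSquare (gramDet (Q.restrict U)) ↔ IsSquare (gramDet (Q.restrict U'))) :
    U ⊓ U' ≠ ⊥ := by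
  classical
  have : Finite V := Module.finite_of_finite F
  have : Fintype V := Fintype.ofFinite V
  have h2 : (2 : F) ≠ 0 := Ring.two_ne_zero (ringChar_ne_two_of_odd (by rw [h3]; decide))
  obtain ⟨u, hu, hu0⟩ := U.exists_mem_ne_zero_of_ne_bot (by
    rintro rfl
    simp at hd)
  obtain ⟨u', hu', hu0'⟩ := U'.exists_mem_ne_zero_of_ne_bot (by
    rintro rfl
    simp at hd')
  have hQu := hU.map_ne_zero_of_finrank_eq_one hd hu hu0
  have hQu' := hU'.map_ne_zero_of_finrank_eq_one hd' hu' hu0'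
  rw [isSquare_gramDet_line hd hu hu0, isSquare_gramDet_line hd' hu' hu0'] at hsq
  have heq : Q u = Q u' :=
    mul_left_cancel₀ h2 (eq_of_isSquare_iff h3 (mul_ne_zero h2 hQu) (mul_ne_zero h2 hQu') hsq)
  intro hbot
  have hnot : u' ∉ U := fun h => hu0' ((Submodule.mem_bot F).1 (hbot ▸ ⟨h, hu'⟩))
  -- Only $q-1=2$ vectors take the value $Q(u)$, whereas `u`, `-u` and `u'` would be three.
  have hcount : nonzeroCount Q ⊤ (Q u) = 2 := by
    have h := hs.mul_nonzeroCount_of_ne_zero hQu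
    rw [h3] at h
    push_cast at h
    omega
  have hneg : u ≠ -u := fun h => by
    have h4 : (2 : F) • u = 0 := by
      rw [two_smul]
      nth_rewrite 1 [h]
      exact neg_add_cancel u
    exact (smul_ne_zero h2 hu0) h4
  have hsub : ({u, -u, u'} : Finset V) ⊆
      Finset.univ.filter fun v => v ∈ (⊤ : Submodule F V) ∧ v ≠ 0 ∧ Q v = Q u := by
    intro x hx
    simp only [Finset.mem_insert, Finset.mem_singleton] at hx
    rcases hx with rfl | rfl | rfl
    · simp [hu0]
    · simp [hu0]
    · simp [hu0', heq]
  have hle := Finset.card_le_card hsub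
  have hcard : ({u, -u, u'} : Finset V).card = 3 := by
    have h5 : u ≠ u' := fun h => hnot (h ▸ hu)
    have h6 : -u ≠ u' := fun h => hnot (h ▸ U.neg_mem hu)
    rw [Finset.card_insert_of_notMem (by simp [hneg, h5]), Finset.card_pair h6]
  have h7 : nonzeroCount Q ⊤ (Q u) =
      (Finset.univ.filter fun v => v ∈ (⊤ : Submodule F V) ∧ v ≠ 0 ∧ Q v = Q u).card := by
    rw [nonzeroCount, Nat.card_eq_fintype_card, Fintype.card_subtype]
  rw [← h7, hcard, hcount] at hle
  omega

end Lines

/-! ### From the averaged bound to the proportion. -/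

section Proportion

variable {F : Type*} [Field F] [Finite F] {V : Type*} [AddCommGroup V] [Module F V]
  [Module.Finite F V] {Q : QuadraticForm F V}

omit [Finite F] in
theorem isNondegenerateOn_of_mem {n : ℕ} {σ : Sign} {U : Submodule F V}
    (hU : U ∈ nondegSubspaces Q n σ) : IsNondegenerateOn Q U :=
  (isNondegenerate_restrict_iff Q U).1 hU.2.1

theorem meetProportion_le (hq : 3 ≤ Nat.card F) (hQ : IsNondegenerate Q) {n n' : ℕ} {σ σ' : Sign}
    (hn : 1 ≤ n) (hn' : 1 ≤ n') (hd : finrank F V = n + n') {U : Submodule F V}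
    (hU : U ∈ nondegSubspaces Q n σ) (hne : (nondegSubspaces Q n' σ').Nonempty)
    (hex : ¬ (n = 1 ∧ n' = 1 ∧ Nat.card F = 3 ∧ HasSignedCounts Q (⊤ : Submodule F V) 1 1)) :
    meetProportion U (nondegSubspaces Q n' σ') ≤ 43 / (16 * (Nat.card F : ℚ)) := by
  classical
  have : Fintype F := Fintype.ofFinite F
  have : Finite V := Module.finite_of_finite F
  have : Finite (Submodule F V) := Finite.of_injective _ SetLike.coe_injective
  have : Fintype (Submodule F V) := Fintype.ofFinite _
  have hq' : (3 : ℚ) ≤ Nat.card F := by exact_mod_cast hq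
  set S : Finset (Submodule F V) := (nondegSubspaces Q n' σ').toFinset with hSdef
  have hmem : ∀ W, W ∈ S ↔ W ∈ nondegSubspaces Q n' σ' := fun W => Set.mem_toFinset
  have h1 := mul_card_filter_inf_ne_bot_le hq hQ (S := S)
    (fun g hg W hW => (hmem _).2 (map_mem_nondegSubspaces hg ((hmem W).1 hW))) U
  have h2 : ∑ W ∈ S, pairSum Q U W ≤
      S.card • (43 / (16 * (Nat.card F : ℚ)) * (Nat.card F - 1)) := by
    refine Finset.sum_le_card_nsmul _ _ _ fun W hW => ?_
    have hW' := (hmem W).1 hW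
    have e1 := hU.1
    have e2 := hW'.1
    refine pairSum_le_bound hq hQ (isNondegenerateOn_of_mem hU) (isNondegenerateOn_of_mem hW')
      (by omega) (by omega) (by omega) ?_
    rw [e1, e2]
    exact hex
  have h3 : (nondegSubspaces Q n' σ').ncard = S.card := Set.ncard_eq_toFinset_card' _
  have h4 : {U' ∈ nondegSubspaces Q n' σ' | U ⊓ U' ≠ ⊥}.ncard =
      (S.filter fun W => U ⊓ W ≠ ⊥).card := by
    rw [← Set.ncard_coe_finset]
    congr 1
    ext W
    simp [hmem]
  have hpos : (0 : ℚ) < S.card := by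
    obtain ⟨W, hW⟩ := hne
    exact_mod_cast Finset.card_pos.2 ⟨W, (hmem W).2 hW⟩
  rw [meetProportion, h3, h4, div_le_iff₀ hpos]
  have h5 := h1.trans h2
  rw [nsmul_eq_mul] at h5
  refine le_of_mul_le_mul_left (h5.trans (le_of_eq ?_)) (by linarith : 0 < (Nat.card F : ℚ) - 1)
  ring

omit [Finite F] in
-- Lines that meet non-trivially are equal, and a line has only one type.
theorem meetProportion_lines_eq_zero (hQ : IsNondegenerate Q) (hd : finrank F V = 2)
    {σ σ' : Sign} (hσ : σ ≠ σ') {U : Submodule F V} (hU : U ∈ nondegSubspaces Q 1 σ) :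
    meetProportion U (nondegSubspaces Q 1 σ') = 0 := by
  have hempty : {U' ∈ nondegSubspaces Q 1 σ' | U ⊓ U' ≠ ⊥} = ∅ := by
    refine Set.eq_empty_of_forall_notMem ?_
    rintro W ⟨hW, hmeet⟩
    have e1 := hU.1
    have e2 := hW.1
    have hpos : 1 ≤ finrank F (U ⊓ W : Submodule F V) := by
      rw [Nat.one_le_iff_ne_zero, ne_eq, Submodule.finrank_eq_zero]
      exact hmeet
    have h1 : U ⊓ W = U := Submodule.eq_of_le_of_finrank_le inf_le_left (by omega)
    have h2 : U ⊓ W = W := Submodule.eq_of_le_of_finrank_le inf_le_right (by omega)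
    obtain rfl : U = W := h1.symm.trans h2
    exact hσ (HasDelta.unique ((hasDelta_iff_of_finrank_eq_one hQ hd e1).1 hU.2.2)
      ((hasDelta_iff_of_finrank_eq_one hQ hd e1).1 hW.2.2))
  rw [meetProportion, hempty, Set.ncard_empty, Nat.cast_zero, zero_div]

theorem meetProportion_lines_eq_one (hQ : IsNondegenerate Q) (hd : finrank F V = 2)
    (h3 : Nat.card F = 3) (hε : HasIsometryType Q .hyperbolic) {σ : Sign} {U : Submodule F V}
    (hU : U ∈ nondegSubspaces Q 1 σ) : meetProportion U (nondegSubspaces Q 1 σ) = 1 := by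
  have : Finite V := Module.finite_of_finite F
  have : Finite (Submodule F V) := Finite.of_injective _ SetLike.coe_injective
  have hs := hasSignedCounts_of_hyperbolic hQ (m := 1) hd hε
  have hall : {U' ∈ nondegSubspaces Q 1 σ | U ⊓ U' ≠ ⊥} = nondegSubspaces Q 1 σ := by
    refine Set.sep_eq_self_iff_mem_true.2 fun W hW => ?_
    refine inf_ne_bot_of_hyperbolic_plane h3 hs (isNondegenerateOn_of_mem hU)
      (isNondegenerateOn_of_mem hW) hU.1 hW.1 ?_
    have d1 := (hasDelta_iff_of_finrank_eq_one hQ hd hU.1).1 hU.2.2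
    have d2 := (hasDelta_iff_of_finrank_eq_one hQ hd hW.1).1 hW.2.2
    cases σ
    · exact iff_of_true d1 d2
    · exact iff_of_false d1 d2
  have hpos : 0 < (nondegSubspaces Q 1 σ).ncard :=
    (Set.ncard_pos (Set.toFinite _)).2 ⟨U, hU⟩
  rw [meetProportion, hall]
  exact div_self (by exact_mod_cast hpos.ne')

end Proportion
end OrthSpace
end

theorem theoremT {F : Type*} [Field F] [Finite F]
    {V : Type*} [AddCommGroup V] [Module F V] [Module.Finite F V]
    (q n n' : ℕ) (hqF : Nat.card F = q) (hn : 1 ≤ n) (hn' : 1 ≤ n') (hq : 3 ≤ q)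
    (hodd : Odd n ∨ Odd n' → Odd q)
    (hV : Module.finrank F V = n + n')
    (Q : QuadraticForm F V) (hQ : OrthSpace.IsNondegenerate Q)
    (ε : OrthSpace.IsometryType) (hε : OrthSpace.HasIsometryType Q ε)
    (σ σ' : OrthSpace.Sign)
    (U : Submodule F V) (hU : U ∈ OrthSpace.nondegSubspaces Q n σ) :
    (OrthSpace.nondegSubspaces Q n' σ').Nonempty ∧
    (¬ (n = 1 ∧ n' = 1 ∧ q = 3 ∧ ε = .hyperbolic ∧ σ = σ') →
      OrthSpace.meetProportion U (OrthSpace.nondegSubspaces Q n' σ') ≤ 43 / (16 * (q : ℚ))) ∧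
    (n = 1 ∧ n' = 1 ∧ q = 3 ∧ ε = .hyperbolic ∧ σ = σ' →
      OrthSpace.meetProportion U (OrthSpace.nondegSubspaces Q n' σ') = 1) := by
  open OrthSpace in
  subst hqF
  have hne := nondegSubspaces_nonempty hQ hn hn' hodd hV σ'
  refine ⟨hne, fun hex => ?_, ?_⟩
  -- The union bound misses two lines in a hyperbolic plane over $\mathbb F_3$ whatever their types;
  -- outside the stated exception the types differ there and the proportion is 0.
  · by_cases h : n = 1 ∧ n' = 1 ∧ Nat.card F = 3 ∧ HasSignedCounts Q (⊤ : Submodule F V) 1 1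
    · obtain ⟨rfl, rfl, h3, hs⟩ := h
      have hε' := eq_hyperbolic_of_hasSignedCounts hV hs hε
      rw [meetProportion_lines_eq_zero hQ hV (fun hσ => hex ⟨rfl, rfl, h3, hε', hσ⟩) hU]
      positivity
    · exact meetProportion_le hq hQ hn hn' hV hU hne h
  · rintro ⟨rfl, rfl, h3, rfl, rfl⟩
    exact meetProportion_lines_eq_one hQ hV h3 hε hU
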